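/- **Conventions.** A polygonal domain $P\subset\mathbb R^2$ is the closed region enclosed by a simple polygon (the outer boundary) minus the interiors of finitely many simple polygons (the holes), whose closed regions are pairwise disjoint and lie in the interior of the outer polygon. Its size is its total number of vertices. It is rectilinear if every edge of its outer boundary and of its holes is horizontal or vertical. For $s,t\in P$, a $k$-link path from $s$ to $t$ is a sequence $s=v_0,v_1,\dots,v_k=t$ of points such that every segment $v_iv_{i+1}$ (of arbitrary orientation) lies in $P$; the link distance between $s$ and $t$ is the least such $k$. 3SUM is the problem: given a set $S$ of $n$ integers, are there $a,b,c\in S$ (not necessarily distinct) with $a+b+c=0$? A problem $B$ is *3SUM-hard* if there are constants $k$, $C$ and $\delta>0$ and a real RAM program (exact $+,-,\times,/$ and comparisons of reals at unit cost, memory indexed by natural numbers, integer constants, no floor function) with access to an oracle for $B$ that solves every 3SUM instance of size $n$ using at most $k$ oracle calls, each on an instance of $B$ of size at most $C(n+1)$, and at most $C(n+1)^{2-\delta}$ additional steps. **Theorem.** Determining the link distance, for paths with unrestricted orientations, between two given points of a polygonal domain with holes is 3SUM-hard. In particular, it is 3SUM-hard to decide whether there exists a 3-link path (with links of unrestricted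 orientation) between two given points of a rectilinear polygonal domain. Both hold even if the instances of the problem are restricted to domains with at least one hole. -/

import Mathlib

/-! ## The machine model: a real RAM with a step count and oracle calls -/

namespace RealRAM

/-- The memory of a real RAM: countably many arrays of natural numbers (index arrays) and
countably many arrays of real numbers.  A program mentions array names explicitly, hence uses
only finitely many arrays; cell `0` of an array serves as a register. -/
structure Store where
  nat : ℕ → ℕ → ℕ
  real : ℕ → ℕ → ℝ

/-- Index expressions: constants, (indirect) memory access, addition, truncated subtraction. -/
inductive NExp where
  | const (k : ℕ)
  | get (a : ℕ) (i : NExp)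
  | add (e f : NExp)
  | sub (e f : NExp)

/-- Real expressions: integer constants, memory access at a computed index, field operations.
There is no floor function and no conversion from reals to indices. -/
inductive RExp where
  | const (k : ℤ)
  | get (a : ℕ) (i : NExp)
  | add (e f : RExp)
  | sub (e f : RExp)
  | mul (e f : RExp)
  | div (e f : RExp)

/-- Tests: comparisons of indices and of reals, and Boolean combinations. -/
inductive Test where
  | natLt (e f : NExp)
  | realLt (e f : RExp)
  | not (b : Test)
  | and (b c : Test)

/-- Value of an index expression. -/
def NExp.eval (σ : Store) : NExp → ℕ
  | .const k => k
  | .get a i => σ.nat a (i.eval σ)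
  | .add e f => e.eval σ + f.eval σ
  | .sub e f => e.eval σ - f.eval σ

/-- Value of a real expression (exact arithmetic; division by zero yields `0`). -/
noncomputable def RExp.eval (σ : Store) : RExp → ℝ
  | .const k => (k : ℝ)
  | .get a i => σ.real a (i.eval σ)
  | .add e f => e.eval σ + f.eval σ
  | .sub e f => e.eval σ - f.eval σ
  | .mul e f => e.eval σ * f.eval σ
  | .div e f => e.eval σ / f.eval σ

/-- Truth of a test. -/
def Test.holds (σ : Store) : Test → Prop
  | .natLt e f => e.eval σ < f.eval σ
  | .realLt e f => e.eval σ < f.eval σ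
  | .not b => ¬ b.holds σ
  | .and b c => b.holds σ ∧ c.holds σ

/-- Write `v` into cell `i` of index array `a`. -/
def Store.setNat (σ : Store) (a i v : ℕ) : Store :=
  { σ with nat := Function.update σ.nat a (Function.update (σ.nat a) i v) }

/-- Write `v` into cell `i` of real array `a`. -/
def Store.setReal (σ : Store) (a i : ℕ) (v : ℝ) : Store :=
  { σ with real := Function.update σ.real a (Function.update (σ.real a) i v) }

/-- The first `len` entries of real array `a`. -/
def Store.slice (σ : Store) (a len : ℕ) : List ℝ :=
  (List.range len).map (σ.real a)

/-- Programs.  `query a len d` hands the first `len` entries of real array `a` to the oracle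
and stores its answer in cell `0` of index array `d`. -/
inductive Cmd where
  | skip
  | seq (c d : Cmd)
  | putNat (a : ℕ) (i e : NExp)
  | putReal (a : ℕ) (i : NExp) (e : RExp)
  | ite (b : Test) (c d : Cmd)
  | while (b : Test) (c : Cmd)
  | query (a : ℕ) (len : NExp) (d : ℕ)

/-- `Exec O c σ σ' t qs`: run with oracle `O` from store `σ`, the program `c` halts in store `σ'`
after `t` steps, having asked the queries `qs` in this order.  Each assignment, each evaluation of
a test and each query is one step; as the expressions in a program have fixed size, this is the
number of unit-cost operations up to a constant factor that depends only on the program. -/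
inductive Exec (O : List ℝ → ℕ) : Cmd → Store → Store → ℕ → List (List ℝ) → Prop where
  | skip (σ : Store) : Exec O .skip σ σ 0 []
  | seq {c d : Cmd} {σ σ' σ'' : Store} {t t' : ℕ} {qs qs' : List (List ℝ)}
      (hc : Exec O c σ σ' t qs) (hd : Exec O d σ' σ'' t' qs') :
      Exec O (.seq c d) σ σ'' (t + t') (qs ++ qs')
  | putNat (a : ℕ) (i e : NExp) (σ : Store) :
      Exec O (.putNat a i e) σ (σ.setNat a (i.eval σ) (e.eval σ)) 1 []
  | putReal (a : ℕ) (i : NExp) (e : RExp) (σ : Store) :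
      Exec O (.putReal a i e) σ (σ.setReal a (i.eval σ) (e.eval σ)) 1 []
  | ite_true {b : Test} {c d : Cmd} {σ σ' : Store} {t : ℕ} {qs : List (List ℝ)}
      (hb : b.holds σ) (hc : Exec O c σ σ' t qs) :
      Exec O (.ite b c d) σ σ' (t + 1) qs
  | ite_false {b : Test} {c d : Cmd} {σ σ' : Store} {t : ℕ} {qs : List (List ℝ)}
      (hb : ¬ b.holds σ) (hd : Exec O d σ σ' t qs) :
      Exec O (.ite b c d) σ σ' (t + 1) qs
  | while_true {b : Test} {c : Cmd} {σ σ' σ'' : Store} {t t' : ℕ} {qs qs' : List (List ℝ)}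
      (hb : b.holds σ) (hc : Exec O c σ σ' t qs) (hw : Exec O (.while b c) σ' σ'' t' qs') :
      Exec O (.while b c) σ σ'' (t + t' + 1) (qs ++ qs')
  | while_false {b : Test} {c : Cmd} {σ : Store} (hb : ¬ b.holds σ) :
      Exec O (.while b c) σ σ 1 []
  | query (a : ℕ) (len : NExp) (d : ℕ) (σ : Store) :
      Exec O (.query a len d) σ (σ.setNat d 0 (O (σ.slice a (len.eval σ)))) 1
        [σ.slice a (len.eval σ)]

/-- Initial store on input `l`: real array `0` holds `l`, cell `0` of index array `0` holds the
length of `l`, and every other cell is `0`. -/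
def initStore (l : List ℝ) : Store where
  nat a i := if a = 0 ∧ i = 0 then l.length else 0
  real a i := if a = 0 then l.getD i 0 else 0

end RealRAM

/-! ## Problems, subquadratic reductions, 3SUM-hardness -/

/-- A computational problem: instances, their size, their presentation to the machine as a list of
reals, and the correct answer (for a decision problem, `1` for yes and `0` for no). -/
structure Problem where
  Inst : Type
  size : Inst → ℕ
  encode : Inst → List ℝ
  encode_injective : Function.Injective encode
  answer : Inst → ℕ

/-- `O` is an oracle for `B`: it answers every instance of `B` correctly, and may do anything on
lists that encode no instance. -/
def Problem.IsOracle (B : Problem) (O : List ℝ → ℕ) : Prop :=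
  ∀ y : B.Inst, O (B.encode y) = B.answer y

/-- Subquadratic reducibility of `A` to `B`: there is a program that, given an oracle for `B`,
solves every instance of `A` of size `n`, with the answer in cell `0` of index array `0`, using at
most a constant number of oracle calls, all on instances of `B` of size `O(n)`, and `O(n^(2-δ))`
additional time, for some constant `δ > 0`. -/
def SubquadraticallyReducible (A B : Problem) : Prop :=
  ∃ (c : RealRAM.Cmd) (k C : ℕ) (δ : ℝ), 0 < δ ∧
    ∀ O : List ℝ → ℕ, B.IsOracle O → ∀ x : A.Inst,
      ∃ (σ : RealRAM.Store) (t : ℕ) (qs : List (List ℝ)),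
        RealRAM.Exec O c (RealRAM.initStore (A.encode x)) σ t qs ∧
        σ.nat 0 0 = A.answer x ∧
        qs.length ≤ k ∧
        (∀ q ∈ qs, ∃ y : B.Inst, B.encode y = q ∧ B.size y ≤ C * (A.size x + 1)) ∧
        (t : ℝ) ≤ C * ((A.size x : ℝ) + 1) ^ (2 - δ)

open Classical in
/-- 3SUM: given a set of `n` integers (listed in any order), are there elements `a`, `b`, `c` of
it with `a + b + c = 0`? -/
noncomputable def threeSum : Problem where
  Inst := {l : List ℤ // l.Nodup}
  size l := l.1.length
  encode l := l.1.map (fun a : ℤ => (a : ℝ))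
  encode_injective _ _ h :=
    Subtype.ext (List.map_injective_iff.2 Int.cast_injective h)
  answer l := if ∃ a ∈ l.1, ∃ b ∈ l.1, ∃ c ∈ l.1, a + b + c = 0 then 1 else 0

/-- A problem is 3SUM-hard if 3SUM is subquadratically reducible to it. -/
def ThreeSumHard (B : Problem) : Prop :=
  SubquadraticallyReducible threeSum B

/-! ## Polygonal domains and link distance -/

/-- The plane. -/
abbrev Plane : Type := ℝ × ℝ

/-- A simple polygon: at least three vertices, all distinct, such that two different edges share no
point except that consecutive edges share their common endpoint. -/
structure SimplePolygon where
  n : ℕ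
  poly : Polygon Plane n
  three_le : 3 ≤ n
  injective : Function.Injective poly.vertices
  simple : ∀ i j : Fin n, i ≠ j → ∀ p ∈ poly.edgeSet ℝ i ∩ poly.edgeSet ℝ j,
    (finRotate n i = j ∧ p = poly j) ∨ (finRotate n j = i ∧ p = poly i)

namespace SimplePolygon

/-- The boundary: the union of the edges. -/
def boundary (Q : SimplePolygon) : Set Plane :=
  Q.poly.boundary ℝ

/-- The open region enclosed by the polygon: the points off the boundary whose connected component
in the complement of the boundary is bounded. -/
def inside (Q : SimplePolygon) : Set Plane :=
  {p | p ∉ Q.boundary ∧ Bornology.IsBounded (connectedComponentIn Q.boundaryᶜ p)}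

/-- The closed region enclosed by the polygon. -/
def closedRegion (Q : SimplePolygon) : Set Plane :=
  Q.boundary ∪ Q.inside

/-- Every edge is horizontal or vertical. -/
def IsRectilinear (Q : SimplePolygon) : Prop :=
  ∀ i : Fin Q.n, (Q.poly i).1 = (Q.poly (finRotate Q.n i)).1 ∨
    (Q.poly i).2 = (Q.poly (finRotate Q.n i)).2

/-- Number of vertices, followed by the coordinates of the vertices in cyclic order. -/
def encode (Q : SimplePolygon) : List ℝ :=
  (Q.n : ℝ) :: (List.ofFn fun i => [(Q.poly i).1, (Q.poly i).2]).flatten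

end SimplePolygon

/-- A polygonal domain, given by its outer boundary and its holes: pairwise disjoint simple polygons
inside the outer boundary. -/
structure PolygonalDomain where
  outer : SimplePolygon
  holes : List SimplePolygon
  holes_subset : ∀ H ∈ holes, H.closedRegion ⊆ outer.inside
  holes_disjoint : holes.Pairwise fun H K => Disjoint H.closedRegion K.closedRegion

namespace PolygonalDomain

/-- The points of the domain: those enclosed by the outer boundary and not interior to a hole
(boundaries belong to the domain). -/
def carrier (P : PolygonalDomain) : Set Plane :=
  P.outer.closedRegion \ ⋃ H ∈ P.holes, H.inside

/-- The total number of vertices. -/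
def numVertices (P : PolygonalDomain) : ℕ :=
  P.outer.n + (P.holes.map SimplePolygon.n).sum

/-- All edges, of the outer boundary and of the holes, are horizontal or vertical. -/
def IsRectilinear (P : PolygonalDomain) : Prop :=
  P.outer.IsRectilinear ∧ ∀ H ∈ P.holes, H.IsRectilinear

/-- There is a polygonal path with `k` links (edges, of arbitrary orientation) from `s` to `t`
in the domain. -/
def HasLinkPath (P : PolygonalDomain) (s t : Plane) (k : ℕ) : Prop :=
  ∃ v : ℕ → Plane, v 0 = s ∧ v k = t ∧ ∀ i < k, segment ℝ (v i) (v (i + 1)) ⊆ P.carrier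

/-- The link distance: the minimum number of links of a path from `s` to `t` in the domain
(`⊤` if there is no path). -/
noncomputable def linkDist (P : PolygonalDomain) (s t : Plane) : ℕ∞ :=
  ⨅ (k : ℕ) (_ : P.HasLinkPath s t k), (k : ℕ∞)

end PolygonalDomain

/-- An instance of the minimum-link path problem: a polygonal domain and two of its points. -/
structure LinkInstance where
  domain : PolygonalDomain
  s : Plane
  t : Plane
  s_mem : s ∈ domain.carrier
  t_mem : t ∈ domain.carrier

/-- The coordinates of `s` and `t`, then the outer boundary, then the holes. -/
def LinkInstance.encode (I : LinkInstance) : List ℝ :=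
  [I.s.1, I.s.2, I.t.1, I.t.2] ++
    (I.domain.outer.encode ++ (I.domain.holes.map SimplePolygon.encode).flatten)

theorem SimplePolygon.encode_append_inj {Q R : SimplePolygon} {l l' : List ℝ}
    (h : Q.encode ++ l = R.encode ++ l') : Q = R ∧ l = l' := by
  obtain ⟨n, ⟨v⟩, h1, h2, h3⟩ := Q
  obtain ⟨m, ⟨w⟩, g1, g2, g3⟩ := R
  simp only [SimplePolygon.encode, List.cons_append, List.cons.injEq, Nat.cast_inj] at h
  obtain ⟨rfl, h⟩ := h
  have key : ∀ (L L' : List Plane), L.length = L'.length →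
      (L.map fun p => [p.1, p.2]).flatten ++ l = (L'.map fun p => [p.1, p.2]).flatten ++ l' →
      L = L' ∧ l = l' := by
    intro L
    induction L with
    | nil =>
      intro L' hL hh
      obtain rfl : L' = [] := by simpa [eq_comm] using hL
      simpa using hh
    | cons p L ih =>
      intro L' hL hh
      cases L' with
      | nil => simp at hL
      | cons q L' =>
        simp only [List.map_cons, List.flatten_cons, List.cons_append, List.nil_append,
          List.cons.injEq] at hh
        obtain ⟨hp1, hp2, hh⟩ := hh
        obtain ⟨e1, e2⟩ := ih L' (by simpa using hL) hh
        exact ⟨by rw [e1, Prod.ext hp1 hp2], e2⟩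
  have := key (List.ofFn v) (List.ofFn w) (by simp) (by
    simpa [List.map_ofFn, Function.comp_def] using h)
  obtain ⟨e1, e2⟩ := this
  obtain rfl := List.ofFn_injective e1
  exact ⟨rfl, e2⟩

theorem LinkInstance.encode_injective : Function.Injective LinkInstance.encode := by
  have key : ∀ L L' : List SimplePolygon,
      (L.map SimplePolygon.encode).flatten = (L'.map SimplePolygon.encode).flatten →
      L = L' := by
    intro L
    induction L with
    | nil =>
      intro L' h
      cases L' with
      | nil => rfl
      | cons Q L' => simp [SimplePolygon.encode] at h
    | cons Q L ih =>
      intro L' h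
      cases L' with
      | nil => simp [SimplePolygon.encode] at h
      | cons R L' =>
        simp only [List.map_cons, List.flatten_cons] at h
        obtain ⟨e, h⟩ := SimplePolygon.encode_append_inj h
        rw [e, ih L' h]
  rintro ⟨⟨o, hs, a1, a2⟩, ⟨s1, s2⟩, ⟨t1, t2⟩, a3, a4⟩
    ⟨⟨o', hs', b1, b2⟩, ⟨s1', s2'⟩, ⟨t1', t2'⟩, b3, b4⟩ h
  simp only [LinkInstance.encode, List.cons_append, List.nil_append, List.cons.injEq] at h
  obtain ⟨rfl, rfl, rfl, rfl, h⟩ := h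
  obtain ⟨rfl, h'⟩ := SimplePolygon.encode_append_inj h
  obtain rfl := key _ _ h'
  rfl

open Classical in
/-- Determining the link distance (for paths with unrestricted orientations) between two points of
a polygonal domain with at least one hole.  The answer is `d + 1` if the link distance is `d`, and
`0` if it is infinite. -/
noncomputable def linkDistanceProblem : Problem where
  Inst := {I : LinkInstance // I.domain.holes ≠ []}
  size I := I.1.domain.numVertices
  encode I := I.1.encode
  encode_injective := LinkInstance.encode_injective.comp Subtype.val_injective
  answer I :=
    if I.1.domain.linkDist I.1.s I.1.t = ⊤ then 0
    else (I.1.domain.linkDist I.1.s I.1.t).toNat + 1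

open Classical in
/-- Deciding whether there is a path with three links (of unrestricted orientations) between two
points of a rectilinear polygonal domain with at least one hole. -/
noncomputable def rectilinearThreeLinkProblem : Problem where
  Inst := {I : LinkInstance // I.domain.holes ≠ [] ∧ I.domain.IsRectilinear}
  size I := I.1.domain.numVertices
  encode I := I.1.encode
  encode_injective := LinkInstance.encode_injective.comp Subtype.val_injective
  answer I := if I.1.domain.HasLinkPath I.1.s I.1.t 3 then 1 else 0

/-! 3SUM is reduced to the existence of a three-link path in a rectangle with rectangular holes.
Three horizontal walls, at equidistant heights, have narrow gaps centred at `8 a`, at `-4 c` and at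
`8 b`, for `a`, `b`, `c` in the given set.  A line through gaps `8 a` of the lower wall and `8 b` of
the upper wall meets the middle height near `4 (a + b)`, so for integers it can pass through a gap
`-4 c` of the middle wall exactly if `a + b + c = 0`.  The source lies in a low corridor under the
lower wall, the target in one over the upper wall.  Horizontal first and last links reach the ends
of every such line, so a solution gives a three-link path (`Framed.freeSegment_of_solution`).

Conversely, the first link is so flat that it cannot get through a gap of the thick wall
(`Framed.link_stays_low`).  As holes must not touch the outer boundary, the walls can also be passed
at their ends; blockers in the corridors, with cracks above and below, keep the first and the
last link away from there (`Framed.link_stays_central`).  So the middle link crosses all three walls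
at true gaps (`Framed.near_solution_of_free`).  The link distance is then at most three exactly if
the 3SUM instance has a solution (`Framed.hasLinkPath_iff`).

All polygons involved are rectangles, whose enclosed region is determined by rays that escape to
infinity (`mem_inside_rectanglePolygon`).

The holes are the parts of the walls between consecutive gaps, so the machine has to sort the
numbers.  It merges sorted runs in a queue: the two runs at the head of the queue are replaced by
their merge at its tail (`RunQueue`).  Run
number `m` has length at most `(2 n - 1) / (2 n - 1 - m)`, whence a harmonic sum bounds the running
time (`sum_merge_steps_le`).  After sorting, the machine computes a bound `M`, which sets the scale
of the domain, writes the encoding of the instance, and asks the oracle once. -/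

/-! ### Rectangles as simple polygons -/

/-- The rectangle `[x₁, x₂] × [y₁, y₂]`, listed counterclockwise from its lower left corner. -/
noncomputable def rectangleVertices (x₁ x₂ y₁ y₂ : ℝ) : Polygon Plane 4 :=
  ⟨![(x₁, y₁), (x₂, y₁), (x₂, y₂), (x₁, y₂)]⟩

theorem segment_horizontal {a b c : ℝ} (hab : a ≤ b) :
    segment ℝ ((a, c) : Plane) (b, c) = {p | a ≤ p.1 ∧ p.1 ≤ b ∧ p.2 = c} := by
  rw [← Prod.image_mk_segment_left, segment_eq_Icc hab]
  ext ⟨x, y⟩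
  simp only [Set.mem_image, Set.mem_Icc, Prod.mk.injEq, Set.mem_ofPred_eq]
  constructor
  · rintro ⟨z, hz, rfl, rfl⟩
    exact ⟨hz.1, hz.2, rfl⟩
  · rintro ⟨h1, h2, rfl⟩
    exact ⟨x, ⟨h1, h2⟩, rfl, rfl⟩

theorem segment_vertical {a b c : ℝ} (hab : a ≤ b) :
    segment ℝ ((c, a) : Plane) (c, b) = {p | p.1 = c ∧ a ≤ p.2 ∧ p.2 ≤ b} := by
  rw [← Prod.image_mk_segment_right, segment_eq_Icc hab]
  ext ⟨x, y⟩
  simp only [Set.mem_image, Set.mem_Icc, Prod.mk.injEq, Set.mem_ofPred_eq]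
  constructor
  · rintro ⟨z, hz, rfl, rfl⟩
    exact ⟨rfl, hz.1, hz.2⟩
  · rintro ⟨rfl, h1, h2⟩
    exact ⟨y, ⟨h1, h2⟩, rfl, rfl⟩

section
variable {x₁ x₂ y₁ y₂ : ℝ}

theorem edgeSet_rectangleVertices (hx : x₁ < x₂) (hy : y₁ < y₂) (i : Fin 4) :
    (rectangleVertices x₁ x₂ y₁ y₂).edgeSet ℝ i =
      ![{p | x₁ ≤ p.1 ∧ p.1 ≤ x₂ ∧ p.2 = y₁}, {p | p.1 = x₂ ∧ y₁ ≤ p.2 ∧ p.2 ≤ y₂},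
        {p | x₁ ≤ p.1 ∧ p.1 ≤ x₂ ∧ p.2 = y₂}, {p | p.1 = x₁ ∧ y₁ ≤ p.2 ∧ p.2 ≤ y₂}] i := by
  rw [Polygon.edgeSet, affineSegment_eq_segment]
  fin_cases i
  · exact segment_horizontal hx.le
  · exact segment_vertical hy.le
  · exact (segment_symm ℝ _ _).trans (segment_horizontal hx.le)
  · exact (segment_symm ℝ _ _).trans (segment_vertical hy.le)

/-- A nondegenerate axis-parallel rectangle. -/
noncomputable def rectanglePolygon (x₁ x₂ y₁ y₂ : ℝ) (hx : x₁ < x₂) (hy : y₁ < y₂) :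
    SimplePolygon where
  n := 4
  poly := rectangleVertices x₁ x₂ y₁ y₂
  three_le := by norm_num
  injective := by
    intro i j h
    have := hx.ne
    have := hy.ne
    fin_cases i <;> fin_cases j <;> simp_all [rectangleVertices]
  simple := by
    intro i j hij p hp
    rw [edgeSet_rectangleVertices hx hy, edgeSet_rectangleVertices hx hy] at hp
    obtain ⟨x, y⟩ := p
    have e0 : finRotate 4 0 = 1 := by decide
    have e1 : finRotate 4 1 = 2 := by decide
    have e2 : finRotate 4 2 = 3 := by decide
    have e3 : finRotate 4 3 = 0 := by decide
    have := hx.ne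
    have := hy.ne
    fin_cases i <;> fin_cases j <;> simp [rectangleVertices, e0, e1, e2, e3] at hij hp ⊢ <;> grind

theorem mem_boundary_rectanglePolygon (hx : x₁ < x₂) (hy : y₁ < y₂) {p : Plane} :
    p ∈ (rectanglePolygon x₁ x₂ y₁ y₂ hx hy).boundary ↔
      (x₁ ≤ p.1 ∧ p.1 ≤ x₂ ∧ (p.2 = y₁ ∨ p.2 = y₂)) ∨
      ((p.1 = x₁ ∨ p.1 = x₂) ∧ y₁ ≤ p.2 ∧ p.2 ≤ y₂) := by
  have : p ∈ (rectanglePolygon x₁ x₂ y₁ y₂ hx hy).boundary ↔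
      ∃ i : Fin 4, p ∈ (rectangleVertices x₁ x₂ y₁ y₂).edgeSet ℝ i := by
    simp [SimplePolygon.boundary, Polygon.boundary, rectanglePolygon]
  simp only [this, edgeSet_rectangleVertices hx hy, Fin.exists_fin_succ]
  simp
  tauto

end

/-- A point from which a ray escapes to infinity off the boundary is not enclosed. -/
theorem SimplePolygon.notMem_inside_of_ray {Q : SimplePolygon} {p v : Plane} (hv : ‖v‖ = 1)
    (h : ∀ r : ℝ, 0 ≤ r → p + r • v ∉ Q.boundary) : p ∉ Q.inside := by
  rintro ⟨-, hb⟩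
  have hpre : IsPreconnected ((fun r : ℝ => p + r • v) '' Set.Ici 0) :=
    isPreconnected_Ici.image _ (by fun_prop)
  have hsub := hpre.subset_connectedComponentIn (x := p) (F := Q.boundaryᶜ)
    ⟨0, Set.self_mem_Ici, by simp⟩ (by rintro _ ⟨r, hr, rfl⟩; exact h r hr)
  obtain ⟨C, hC⟩ := (hb.subset hsub).exists_norm_le
  have hC' := hC (p + (|C| + ‖p‖ + 1) • v) ⟨_, by simp only [Set.mem_Ici]; positivity, rfl⟩
  have h1 : ‖(|C| + ‖p‖ + 1) • v‖ = |C| + ‖p‖ + 1 := by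
    rw [norm_smul, hv, mul_one, Real.norm_of_nonneg (by positivity)]
  have h2 := norm_sub_le (p + (|C| + ‖p‖ + 1) • v) p
  rw [add_sub_cancel_left, h1] at h2
  linarith [le_abs_self C]

section
variable {x₁ x₂ y₁ y₂ : ℝ}

theorem mem_inside_rectanglePolygon (hx : x₁ < x₂) (hy : y₁ < y₂) {p : Plane} :
    p ∈ (rectanglePolygon x₁ x₂ y₁ y₂ hx hy).inside ↔
      (x₁ < p.1 ∧ p.1 < x₂) ∧ y₁ < p.2 ∧ p.2 < y₂ := by
  constructor
  · intro hp
    have hnb := hp.1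
    rw [mem_boundary_rectanglePolygon] at hnb
    have hclosed : (x₁ ≤ p.1 ∧ p.1 ≤ x₂) ∧ y₁ ≤ p.2 ∧ p.2 ≤ y₂ := by
      refine ⟨⟨?_, ?_⟩, ?_, ?_⟩ <;> by_contra! hlt
      · refine SimplePolygon.notMem_inside_of_ray (v := (-1, 0)) (by simp [Prod.norm_def]) ?_ hp
        intro r hr
        rw [mem_boundary_rectanglePolygon]
        simp only [Prod.fst_add, Prod.smul_fst, Prod.snd_add, Prod.smul_snd, smul_eq_mul]
        grind
      · refine SimplePolygon.notMem_inside_of_ray (v := (1, 0)) (by simp [Prod.norm_def]) ?_ hp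
        intro r hr
        rw [mem_boundary_rectanglePolygon]
        simp only [Prod.fst_add, Prod.smul_fst, Prod.snd_add, Prod.smul_snd, smul_eq_mul]
        grind
      · refine SimplePolygon.notMem_inside_of_ray (v := (0, -1)) (by simp [Prod.norm_def]) ?_ hp
        intro r hr
        rw [mem_boundary_rectanglePolygon]
        simp only [Prod.fst_add, Prod.smul_fst, Prod.snd_add, Prod.smul_snd, smul_eq_mul]
        grind
      · refine SimplePolygon.notMem_inside_of_ray (v := (0, 1)) (by simp [Prod.norm_def]) ?_ hp
        intro r hr
        rw [mem_boundary_rectanglePolygon]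
        simp only [Prod.fst_add, Prod.smul_fst, Prod.snd_add, Prod.smul_snd, smul_eq_mul]
        grind
    grind
  · intro hp
    have hnb : p ∉ (rectanglePolygon x₁ x₂ y₁ y₂ hx hy).boundary := by
      rw [mem_boundary_rectanglePolygon]
      grind
    refine ⟨hnb, ?_⟩
    have hsub : connectedComponentIn (rectanglePolygon x₁ x₂ y₁ y₂ hx hy).boundaryᶜ p ⊆
        Set.Ioo x₁ x₂ ×ˢ Set.Ioo y₁ y₂ := by
      refine isPreconnected_connectedComponentIn.subset_left_of_subset_union
        (isOpen_Ioo.prod isOpen_Ioo) (v := (Set.Icc x₁ x₂ ×ˢ Set.Icc y₁ y₂)ᶜ)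
        (isClosed_Icc.prod isClosed_Icc).isOpen_compl ?_ ?_ ?_
      · rw [Set.disjoint_compl_right_iff_subset]
        exact Set.prod_mono Set.Ioo_subset_Icc_self Set.Ioo_subset_Icc_self
      · refine (connectedComponentIn_subset _ _).trans fun q hq => ?_
        rw [Set.mem_compl_iff, mem_boundary_rectanglePolygon] at hq
        simp only [Set.mem_union, Set.mem_prod, Set.mem_Ioo, Set.mem_compl_iff, Set.mem_Icc]
        grind
      · exact ⟨p, mem_connectedComponentIn hnb, hp⟩
    exact ((Metric.isBounded_Ioo _ _).prod (Metric.isBounded_Ioo _ _)).subset hsub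

theorem mem_closedRegion_rectanglePolygon (hx : x₁ < x₂) (hy : y₁ < y₂) {p : Plane} :
    p ∈ (rectanglePolygon x₁ x₂ y₁ y₂ hx hy).closedRegion ↔
      (x₁ ≤ p.1 ∧ p.1 ≤ x₂) ∧ y₁ ≤ p.2 ∧ p.2 ≤ y₂ := by
  rw [SimplePolygon.closedRegion, Set.mem_union, mem_boundary_rectanglePolygon,
    mem_inside_rectanglePolygon]
  grind

theorem isRectilinear_rectanglePolygon (hx : x₁ < x₂) (hy : y₁ < y₂) :
    (rectanglePolygon x₁ x₂ y₁ y₂ hx hy).IsRectilinear := by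
  change ∀ i : Fin 4, (rectangleVertices x₁ x₂ y₁ y₂ i).1 =
      (rectangleVertices x₁ x₂ y₁ y₂ (finRotate 4 i)).1 ∨
    (rectangleVertices x₁ x₂ y₁ y₂ i).2 = (rectangleVertices x₁ x₂ y₁ y₂ (finRotate 4 i)).2
  intro i
  fin_cases i
  exacts [Or.inr rfl, Or.inl rfl, Or.inr rfl, Or.inl rfl]

theorem encode_rectanglePolygon (hx : x₁ < x₂) (hy : y₁ < y₂) :
    (rectanglePolygon x₁ x₂ y₁ y₂ hx hy).encode = [4, x₁, y₁, x₂, y₁, x₂, y₂, x₁, y₂] := by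
  simp [SimplePolygon.encode, rectanglePolygon, rectangleVertices, List.ofFn_succ]

end

/-! ### The domain of a 3SUM instance -/

/-- Data of an axis-parallel rectangle `[x₁, x₂] × [y₁, y₂]`. -/
structure Box where
  x₁ : ℝ
  x₂ : ℝ
  y₁ : ℝ
  y₂ : ℝ

namespace Box

/-- The box has nonempty interior. -/
def Nondegenerate (b : Box) : Prop := b.x₁ < b.x₂ ∧ b.y₁ < b.y₂

/-- The closed boxes are disjoint because a coordinate separates them. -/
def Separated (b c : Box) : Prop :=
  b.x₂ < c.x₁ ∨ c.x₂ < b.x₁ ∨ b.y₂ < c.y₁ ∨ c.y₂ < b.y₁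

open Classical in
/-- The boundary polygon of a nondegenerate box; for a degenerate box, the unit square. -/
noncomputable def polygon (b : Box) : SimplePolygon :=
  if h : b.Nondegenerate then rectanglePolygon b.x₁ b.x₂ b.y₁ b.y₂ h.1 h.2
  else rectanglePolygon 0 1 0 1 one_pos one_pos

/-- The description of the polygon of a box as it is presented to the machine. -/
def code (b : Box) : List ℝ := [4, b.x₁, b.y₁, b.x₂, b.y₁, b.x₂, b.y₂, b.x₁, b.y₂]

variable {b c : Box}

theorem mem_inside_polygon (hb : b.Nondegenerate) {p : Plane} :
    p ∈ b.polygon.inside ↔ (b.x₁ < p.1 ∧ p.1 < b.x₂) ∧ b.y₁ < p.2 ∧ p.2 < b.y₂ := by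
  rw [polygon, dif_pos hb, mem_inside_rectanglePolygon]

theorem mem_closedRegion_polygon (hb : b.Nondegenerate) {p : Plane} :
    p ∈ b.polygon.closedRegion ↔ (b.x₁ ≤ p.1 ∧ p.1 ≤ b.x₂) ∧ b.y₁ ≤ p.2 ∧ p.2 ≤ b.y₂ := by
  rw [polygon, dif_pos hb, mem_closedRegion_rectanglePolygon]

theorem encode_polygon (hb : b.Nondegenerate) : b.polygon.encode = b.code := by
  rw [polygon, dif_pos hb, encode_rectanglePolygon, code]

theorem polygon_n : b.polygon.n = 4 := by
  rw [polygon]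
  split_ifs <;> rfl

theorem isRectilinear_polygon : b.polygon.IsRectilinear := by
  rw [polygon]
  split_ifs <;> exact isRectilinear_rectanglePolygon _ _

theorem Separated.disjoint (h : b.Separated c) (hb : b.Nondegenerate) (hc : c.Nondegenerate) :
    Disjoint b.polygon.closedRegion c.polygon.closedRegion := by
  rw [Set.disjoint_left]
  intro p hp hq
  rw [mem_closedRegion_polygon hb] at hp
  rw [mem_closedRegion_polygon hc] at hq
  rcases h with h | h | h | h <;> linarith

end Box

/-- The numbers of a 3SUM instance in increasing order, `D 1, …, D n`, framed by the sentinels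
`D 0 = -16 M` and `D (n + 1) = 16 M`, where `M` bounds their absolute values. -/
structure Framed (D : ℕ → ℝ) (n : ℕ) (M : ℝ) : Prop where
  one_le : 1 ≤ M
  first : D 0 = -16 * M
  last : D (n + 1) = 16 * M
  step : ∀ k ≤ n, D k + 1 ≤ D (k + 1)
  bound : ∀ k, 1 ≤ k → k ≤ n → |D k| ≤ M

/-- The bounding box of the domain. -/
def frameBox (M : ℝ) : Box := ⟨-(128 * M), 128 * M, -(64 * M + 3), 64 * M + 3⟩

/-- The four boxes that close the two corridors, at the bottom and at the top, to the left and to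
the right. -/
noncomputable def blockers (M : ℝ) : List Box :=
  [⟨-(116 * M), -(16 * M), -(64 * M + 5 / 2), -(64 * M + 3 / 2)⟩,
   ⟨16 * M, 116 * M, -(64 * M + 5 / 2), -(64 * M + 3 / 2)⟩,
   ⟨-(116 * M), -(16 * M), 64 * M + 3 / 2, 64 * M + 5 / 2⟩,
   ⟨16 * M, 116 * M, 64 * M + 3 / 2, 64 * M + 5 / 2⟩]

/-- The `k`-th boxes of the three walls, for consecutive numbers `a < b`. -/
def wallBoxes (M a b : ℝ) : List Box :=
  [⟨8 * a + 1, 8 * b - 1, -(64 * M + 1), -(64 * M - 1)⟩,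
   ⟨-(4 * b) + 1, -(4 * a) - 1, -1, 1⟩,
   ⟨8 * a + 1, 8 * b - 1, 64 * M - 1, 64 * M + 1⟩]

/-- All holes of the domain. -/
noncomputable def holeBoxes (D : ℕ → ℝ) (n : ℕ) (M : ℝ) : List Box :=
  blockers M ++ (List.range (n + 1)).flatMap fun k => wallBoxes M (D k) (D (k + 1))

/-- The free points of the domain in coordinates: within the frame, in none of the open boxes of
the walls at heights `± 64 M` and `0`, and in none of the open blockers. -/
def Free (D : ℕ → ℝ) (n : ℕ) (M x y : ℝ) : Prop :=
  |x| ≤ 128 * M ∧ |y| ≤ 64 * M + 3 ∧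
    (∀ k ≤ n, 8 * D k + 1 < x → x < 8 * D (k + 1) - 1 → 64 * M - 1 < |y| → |y| < 64 * M + 1 →
      False) ∧
    (∀ k ≤ n, -(4 * D (k + 1)) + 1 < x → x < -(4 * D k) - 1 → |y| < 1 → False) ∧
    (16 * M < |x| → |x| < 116 * M → 64 * M + 3 / 2 < |y| → |y| < 64 * M + 5 / 2 → False)

namespace Framed

variable {D : ℕ → ℝ} {n : ℕ} {M : ℝ} (h : Framed D n M)
include h

theorem le_of_le {k l : ℕ} (hkl : k ≤ l) (hl : l ≤ n + 1) : D k ≤ D l := by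
  induction l, hkl using Nat.le_induction with
  | base => rfl
  | succ l _ ih => linarith [ih (by omega), h.step l (by omega)]

theorem bounds {k : ℕ} (hk : k ≤ n + 1) : -16 * M ≤ D k ∧ D k ≤ 16 * M :=
  ⟨h.first ▸ h.le_of_le (zero_le) hk, h.last ▸ h.le_of_le hk le_rfl⟩

omit h in
theorem mem_holeBoxes {b : Box} : b ∈ holeBoxes D n M ↔
    b ∈ blockers M ∨ ∃ k ≤ n, b ∈ wallBoxes M (D k) (D (k + 1)) := by
  simp [holeBoxes]

theorem nondegenerate_frameBox : (frameBox M).Nondegenerate := by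
  have := h.one_le
  constructor <;> simp only [frameBox] <;> linarith

theorem nondegenerate_holeBoxes {b : Box} (hb : b ∈ holeBoxes D n M) : b.Nondegenerate := by
  have := h.one_le
  rcases mem_holeBoxes.1 hb with hb | ⟨k, hk, hb⟩
  · simp only [blockers, List.mem_cons, List.not_mem_nil, or_false] at hb
    rcases hb with rfl | rfl | rfl | rfl <;> constructor <;> dsimp only <;> linarith
  · have := h.step k hk
    simp only [wallBoxes, List.mem_cons, List.not_mem_nil, or_false] at hb
    rcases hb with rfl | rfl | rfl <;> constructor <;> dsimp only <;> linarith

theorem subset_frameBox {b : Box} (hb : b ∈ holeBoxes D n M) :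
    b.polygon.closedRegion ⊆ (frameBox M).polygon.inside := by
  have hM := h.one_le
  intro p hp
  rw [Box.mem_closedRegion_polygon (h.nondegenerate_holeBoxes hb)] at hp
  rw [Box.mem_inside_polygon h.nondegenerate_frameBox]
  simp only [frameBox]
  rcases mem_holeBoxes.1 hb with hb | ⟨k, hk, hb⟩
  · simp only [blockers, List.mem_cons, List.not_mem_nil, or_false] at hb
    rcases hb with rfl | rfl | rfl | rfl <;> dsimp only at hp <;>
      refine ⟨⟨?_, ?_⟩, ?_, ?_⟩ <;> linarith
  · have := h.bounds (show k ≤ n + 1 by omega)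
    have := h.bounds (show k + 1 ≤ n + 1 by omega)
    simp only [wallBoxes, List.mem_cons, List.not_mem_nil, or_false] at hb
    rcases hb with rfl | rfl | rfl <;> dsimp only at hp <;>
      refine ⟨⟨?_, ?_⟩, ?_, ?_⟩ <;> linarith

theorem pairwise_separated : (holeBoxes D n M).Pairwise Box.Separated := by
  have hM := h.one_le
  rw [holeBoxes, List.pairwise_append]
  refine ⟨?_, ?_, ?_⟩
  · simp only [blockers, List.pairwise_cons, List.mem_cons, List.not_mem_nil, or_false,
      forall_eq_or_imp, forall_eq, Box.Separated, List.Pairwise.nil, and_true, false_imp_iff,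
      implies_true]
    grind
  · rw [List.pairwise_flatMap]
    constructor
    · intro k _
      simp only [wallBoxes, List.pairwise_cons, List.mem_cons, List.not_mem_nil, or_false,
        forall_eq_or_imp, forall_eq, Box.Separated, List.Pairwise.nil, and_true, false_imp_iff,
        implies_true]
      grind
    · refine List.pairwise_lt_range.imp_of_mem ?_
      intro k l _ hl hkl
      have := h.le_of_le (show k + 1 ≤ l from hkl) (by simp at hl; omega)
      simp only [wallBoxes, List.mem_cons, List.not_mem_nil, or_false, forall_eq_or_imp, forall_eq,
        Box.Separated]
      grind
  · intro b hb c hc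
    simp only [List.mem_flatMap] at hc
    obtain ⟨k, -, hc⟩ := hc
    simp only [blockers, wallBoxes, List.mem_cons, List.not_mem_nil, or_false] at hb hc
    rcases hb with rfl | rfl | rfl | rfl <;> rcases hc with rfl | rfl | rfl <;>
      simp only [Box.Separated] <;> grind

omit h in
/-- The domain of a framed sequence: a rectangle with three walls, at the heights `-64 M`, `0` and
`64 M`, whose gaps are centred at `8 D k`, `-4 D k` and `8 D k`, and with four blockers. -/
noncomputable def domain (h : Framed D n M) : PolygonalDomain where
  outer := (frameBox M).polygon
  holes := (holeBoxes D n M).map Box.polygon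
  holes_subset := by
    simp only [List.mem_map, forall_exists_index, and_imp, forall_apply_eq_imp_iff₂]
    exact fun _ => h.subset_frameBox
  holes_disjoint := by
    rw [List.pairwise_map]
    exact h.pairwise_separated.imp_of_mem fun hb hc hs =>
      hs.disjoint (h.nondegenerate_holeBoxes hb) (h.nondegenerate_holeBoxes hc)

theorem mem_carrier_domain {x y : ℝ} : ((x, y) : Plane) ∈ h.domain.carrier ↔ Free D n M x y := by
  have hM := h.one_le
  have h1 : ((x, y) : Plane) ∈ h.domain.carrier ↔
      ((x, y) : Plane) ∈ (frameBox M).polygon.closedRegion ∧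
      ∀ b ∈ holeBoxes D n M, ((x, y) : Plane) ∉ b.polygon.inside := by
    simp [PolygonalDomain.carrier, domain]
  rw [h1, Box.mem_closedRegion_polygon h.nondegenerate_frameBox]
  have h2 : (∀ b ∈ holeBoxes D n M, ((x, y) : Plane) ∉ b.polygon.inside) ↔
      ∀ b ∈ holeBoxes D n M, ¬ ((b.x₁ < x ∧ x < b.x₂) ∧ b.y₁ < y ∧ y < b.y₂) :=
    forall₂_congr fun b hb => by rw [Box.mem_inside_polygon (h.nondegenerate_holeBoxes hb)]
  rw [h2]
  simp only [frameBox]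
  constructor
  · rintro ⟨⟨hx, hy⟩, H⟩
    have w (k : ℕ) (hk : k ≤ n) (b : Box) (hb : b ∈ wallBoxes M (D k) (D (k + 1))) :=
      H b (mem_holeBoxes.2 (Or.inr ⟨k, hk, hb⟩))
    have b (b : Box) (hb : b ∈ blockers M) := H b (mem_holeBoxes.2 (Or.inl hb))
    simp only [wallBoxes, blockers, List.mem_cons, List.not_mem_nil, or_false, forall_eq_or_imp,
      forall_eq] at w b
    refine ⟨abs_le.2 hx, abs_le.2 hy, fun k hk h1 h2 h3 h4 => ?_, fun k hk h1 h2 h3 => ?_,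
      fun h1 h2 h3 h4 => ?_⟩
    · obtain ⟨w1, -, w3⟩ := w k hk
      rcases abs_cases y with ⟨e, -⟩ | ⟨e, -⟩ <;> rw [e] at h3 h4
      · exact w3 ⟨⟨h1, h2⟩, h3, h4⟩
      · exact w1 ⟨⟨h1, h2⟩, by linarith, by linarith⟩
    · exact (w k hk).2.1 ⟨⟨h1, h2⟩, abs_lt.1 h3⟩
    · obtain ⟨b1, b2, b3, b4⟩ := b
      rcases abs_cases x with ⟨ex, -⟩ | ⟨ex, -⟩ <;> rcases abs_cases y with ⟨ey, -⟩ | ⟨ey, -⟩ <;>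
        rw [ex] at h1 h2 <;> rw [ey] at h3 h4
      · exact b4 ⟨⟨h1, h2⟩, h3, h4⟩
      · exact b2 ⟨⟨h1, h2⟩, by linarith, by linarith⟩
      · exact b3 ⟨⟨by linarith, by linarith⟩, h3, h4⟩
      · exact b1 ⟨⟨by linarith, by linarith⟩, by linarith, by linarith⟩
  · rintro ⟨hx, hy, w1, w2, b⟩
    refine ⟨⟨abs_le.1 hx, abs_le.1 hy⟩, fun c hc => ?_⟩
    rintro ⟨⟨h1, h2⟩, h3, h4⟩
    rcases mem_holeBoxes.1 hc with hc | ⟨k, hk, hc⟩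
    · simp only [blockers, List.mem_cons, List.not_mem_nil, or_false] at hc
      rcases hc with rfl | rfl | rfl | rfl <;> dsimp only at h1 h2 h3 h4
      · rw [abs_of_neg (by linarith : x < 0), abs_of_neg (by linarith : y < 0)] at b
        exact b (by linarith) (by linarith) (by linarith) (by linarith)
      · rw [abs_of_pos (by linarith : 0 < x), abs_of_neg (by linarith : y < 0)] at b
        exact b (by linarith) (by linarith) (by linarith) (by linarith)
      · rw [abs_of_neg (by linarith : x < 0), abs_of_pos (by linarith : 0 < y)] at b
        exact b (by linarith) (by linarith) (by linarith) (by linarith)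
      · rw [abs_of_pos (by linarith : 0 < x), abs_of_pos (by linarith : 0 < y)] at b
        exact b (by linarith) (by linarith) (by linarith) (by linarith)
    · simp only [wallBoxes, List.mem_cons, List.not_mem_nil, or_false] at hc
      rcases hc with rfl | rfl | rfl <;> dsimp only at h1 h2 h3 h4
      · refine w1 k hk h1 h2 ?_ ?_ <;> rw [abs_of_neg (by linarith)] <;> linarith
      · exact w2 k hk h1 h2 (abs_lt.2 ⟨h3, h4⟩)
      · refine w1 k hk h1 h2 ?_ ?_ <;> rw [abs_of_pos (by linarith)] <;> linarith

end Framed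

/-! ### Three-link paths in the domain -/

/-- The free segments, in coordinates. -/
def FreeSegment (D : ℕ → ℝ) (n : ℕ) (M x₀ y₀ x₁ y₁ : ℝ) : Prop :=
  ∀ θ : ℝ, 0 ≤ θ → θ ≤ 1 → Free D n M (x₀ + θ * (x₁ - x₀)) (y₀ + θ * (y₁ - y₀))

theorem free_neg {D : ℕ → ℝ} {n : ℕ} {M x y : ℝ} : Free D n M x (-y) ↔ Free D n M x y := by
  simp [Free]

theorem FreeSegment.reflect {D : ℕ → ℝ} {n : ℕ} {M x₀ y₀ x₁ y₁ : ℝ}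
    (h : FreeSegment D n M x₀ y₀ x₁ y₁) : FreeSegment D n M x₀ (-y₀) x₁ (-y₁) := by
  intro θ h0 h1
  have := free_neg.2 (h θ h0 h1)
  convert this using 1
  ring

theorem FreeSegment.reverse {D : ℕ → ℝ} {n : ℕ} {M x₀ y₀ x₁ y₁ : ℝ}
    (h : FreeSegment D n M x₀ y₀ x₁ y₁) : FreeSegment D n M x₁ y₁ x₀ y₀ := by
  intro θ h0 h1
  convert h (1 - θ) (by linarith) (by linarith) using 1 <;> ring

/-- A number between the ends of a finite sequence lies between two consecutive terms. -/
theorem exists_mem_Icc_succ (E : ℕ → ℝ) (n : ℕ) {x : ℝ} (h0 : E 0 ≤ x) (h1 : x ≤ E (n + 1)) :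
    ∃ k ≤ n, E k ≤ x ∧ x ≤ E (k + 1) := by
  induction n with
  | zero => exact ⟨0, le_rfl, h0, h1⟩
  | succ n ih =>
    rcases le_total x (E (n + 1)) with h | h
    · obtain ⟨k, hk, hk'⟩ := ih h
      exact ⟨k, by omega, hk'⟩
    · exact ⟨n + 1, le_rfl, h, h1⟩

namespace Framed

variable {D : ℕ → ℝ} {n : ℕ} {M : ℝ} (h : Framed D n M)
include h

theorem segment_subset_carrier {p q : Plane} :
    segment ℝ p q ⊆ h.domain.carrier ↔ FreeSegment D n M p.1 p.2 q.1 q.2 := by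
  rw [segment_eq_image']
  simp only [Set.image_subset_iff, FreeSegment]
  refine ⟨fun H θ h0 h1 => ?_, fun H θ hθ => ?_⟩
  · exact h.mem_carrier_domain.1 (H ⟨h0, h1⟩)
  · exact h.mem_carrier_domain.2 (H θ hθ.1 hθ.2)

/-- At the height of an outer wall, only the gaps, and those next to the frame, are free. -/
theorem gap_of_free {x y : ℝ} (hf : Free D n M x y) (hy : |y| = 64 * M) :
    ∃ k ≤ n + 1, |x - 8 * D k| ≤ 1 := by
  obtain ⟨hx, -, hw, -⟩ := hf
  rw [abs_le] at hx
  obtain ⟨k, hk, h1, h2⟩ := exists_mem_Icc_succ (fun k => 8 * D k) n (x := x)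
    (by rw [h.first]; linarith) (by rw [h.last]; linarith)
  by_cases h3 : x ≤ 8 * D k + 1
  · exact ⟨k, by omega, abs_le.2 ⟨by linarith, by linarith⟩⟩
  by_cases h4 : 8 * D (k + 1) - 1 ≤ x
  · exact ⟨k + 1, by omega, abs_le.2 ⟨by linarith, by linarith⟩⟩
  · exact (hw k hk (by linarith) (by linarith) (by linarith) (by linarith)).elim

/-- At the height of the middle wall, only the gaps are free, apart from points far away. -/
theorem middle_gap_of_free {x : ℝ} (hf : Free D n M x 0) (hx : |x| ≤ 9 * M) :
    ∃ k, 1 ≤ k ∧ k ≤ n ∧ |x + 4 * D k| ≤ 1 := by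
  have hM := h.one_le
  obtain ⟨-, -, -, hw, -⟩ := hf
  rw [abs_le] at hx
  obtain ⟨k, hk, h1, h2⟩ := exists_mem_Icc_succ (fun k => 4 * D k) n (x := -x)
    (by rw [h.first]; linarith) (by rw [h.last]; linarith)
  by_cases h3 : -x ≤ 4 * D k + 1
  · refine ⟨k, ?_, hk, abs_le.2 ⟨by linarith, by linarith⟩⟩
    by_contra hk0
    obtain rfl : k = 0 := by omega
    rw [h.first] at h3
    linarith
  by_cases h4 : 4 * D (k + 1) - 1 ≤ -x
  · refine ⟨k + 1, by omega, ?_, abs_le.2 ⟨by linarith, by linarith⟩⟩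
    by_contra hkn
    obtain rfl : k = n := by omega
    rw [h.last] at h4
    linarith
  · exact (hw k hk (by linarith) (by linarith) (by simp)).elim

/-- A link that starts in the middle of the lower corridor does not cross the lower wall: seen from
there, the gaps are too narrow for the thickness of the wall. -/
theorem link_stays_low {x y : ℝ}
    (hs : FreeSegment D n M (-(16 * M)) (-(64 * M + 2)) x y) : y < -(64 * M) := by
  have hM := h.one_le
  by_contra! hy
  set dy := y - -(64 * M + 2) with hdy
  have hdy2 : 2 ≤ dy := by linarith
  set θ := 2 / dy with hθ
  have hθ0 : 0 < θ := by positivity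
  have hθ1 : θ ≤ 1 := (div_le_one (by linarith)).2 hdy2
  have hθdy : θ * dy = 2 := by rw [hθ]; field_simp
  -- `d` is the horizontal distance after which the link reaches the middle of the wall.
  set d := θ * (x - -(16 * M)) with hd
  have hq := hs θ hθ0.le hθ1
  rw [← hd, ← hdy, hθdy] at hq
  obtain ⟨k, hk, hgap⟩ := h.gap_of_free hq (by rw [abs_of_neg] <;> linarith)
  rw [abs_le] at hgap
  -- A point of the link at horizontal distance `3` from there lies in the wall.
  have key : ∀ e : ℝ, (e = 3 ∨ e = -3) → 6 < e * d / 3 → ∀ l ≤ n,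
      8 * D l + 1 < -(16 * M) + d - e → -(16 * M) + d - e < 8 * D (l + 1) - 1 → False := by
    intro e he hed l hl h1 h2
    have hd0 : d ≠ 0 := by rintro h0; rw [h0] at hed; norm_num at hed
    have hed' : 0 < e / d ∧ e / d < 1 / 2 := by
      rcases he with rfl | rfl
      · have : 0 < d := by linarith
        constructor
        · positivity
        · rw [div_lt_div_iff₀ this two_pos]; linarith
      · have : d < 0 := by linarith
        rw [show -3 / d = 3 / (-d) by rw [div_neg, neg_div]]
        constructor
        · exact div_pos three_pos (by linarith)
        · rw [div_lt_div_iff₀ (by linarith) two_pos]; linarith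
    have hf := hs ((1 - e / d) * θ) (mul_nonneg (by linarith) hθ0.le)
      (mul_le_one₀ (by linarith) hθ0.le hθ1)
    rw [mul_assoc, mul_assoc, ← hd, ← hdy, hθdy, sub_mul, div_mul_cancel₀ _ hd0] at hf
    obtain ⟨-, -, hw, -⟩ := hf
    refine hw l hl (by linarith) (by linarith) ?_ ?_ <;> rw [abs_of_neg (by linarith)] <;> linarith
  rcases Nat.eq_zero_or_pos k with rfl | hk0
  · rw [h.first] at hgap
    have h1 : -M ≤ D 1 := by
      rcases Nat.eq_zero_or_pos n with rfl | hn
      · linarith [h.last]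
      · linarith [(abs_le.1 (h.bound 1 le_rfl hn)).1]
    refine key (-3) (Or.inr rfl) (by linarith) 0 (zero_le) ?_ ?_
    · rw [h.first]; linarith
    · rw [zero_add]; linarith
  · obtain ⟨l, rfl⟩ : ∃ l, k = l + 1 := ⟨k - 1, by omega⟩
    have h1 : -M ≤ D (l + 1) := by
      rcases eq_or_ne l n with rfl | hn
      · linarith [h.last]
      · linarith [(abs_le.1 (h.bound (l + 1) (by omega) (by omega))).1]
    have h2 := h.step l (by omega)
    exact key 3 (Or.inl rfl) (by linarith) l (by omega) (by linarith) (by linarith)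

/-- A link that starts in the middle of the lower corridor does not get past the blockers: the
slope needed to pass over or under a blocker takes it out of the corridor before its end. -/
theorem link_stays_central {x y : ℝ}
    (hs : FreeSegment D n M (-(16 * M)) (-(64 * M + 2)) x y) : |x| < 116 * M := by
  have hM := h.one_le
  have hy := h.link_stays_low hs
  by_contra! hx
  set dx := x - -(16 * M) with hdx
  set dy := y - -(64 * M + 2) with hdy
  -- `e` is the signed distance to a point over or under the blocker; the link extends at least four
  -- times as far.  Missing the blocker, it has deviated there by at least `1 / 2` from the middle of
  -- the corridor, whose half-width is `1`.
  have key : ∀ e : ℝ, 0 ≤ e / dx → 4 * (e / dx) ≤ 1 → dx ≠ 0 → 16 * M < |-(16 * M) + e| →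
      |-(16 * M) + e| < 116 * M → False := by
    intro e h0 h1 hne h2 h3
    have hp := hs (e / dx) h0 (by linarith)
    have hq := hs (4 * (e / dx)) (by linarith) h1
    rw [← hdx, ← hdy, div_mul_cancel₀ _ hne] at hp
    rw [← hdx, ← hdy] at hq
    have hlow : e / dx * dy < 2 := by
      rcases le_total dy 0 with hd | hd
      · linarith [mul_nonpos_of_nonneg_of_nonpos h0 hd]
      · nlinarith
    have hlow' : 4 * (e / dx) * dy < 2 := by
      rcases le_total dy 0 with hd | hd
      · linarith [mul_nonpos_of_nonneg_of_nonpos h0 hd]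
      · nlinarith
    have hq2 := (abs_le.1 hq.2.1).1
    obtain ⟨-, hp2, -, -, hb⟩ := hp
    rw [abs_of_neg (show -(64 * M + 2) + e / dx * dy < 0 by linarith)] at hp2 hb
    exact hb h2 h3 (by linarith) (by linarith)
  -- Distances from the source to the points `33 / 2 M` and `-17 M`; four times as far lie
  -- `114 M` and `-20 M`.
  rcases le_abs.1 hx with hx | hx
  · have hpos : 0 < dx := by linarith
    refine key (65 / 2 * M) (by positivity) ?_ hpos.ne' ?_ ?_
    · rw [← mul_div_assoc, div_le_one hpos]; linarith
    · rw [abs_of_pos] <;> linarith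
    · rw [abs_of_pos] <;> linarith
  · have hneg : dx < 0 := by linarith
    refine key (-M) (div_nonneg_of_nonpos (by linarith) hneg.le) ?_ hneg.ne ?_ ?_
    · rw [← mul_div_assoc, div_le_one_of_neg hneg]; linarith
    · rw [abs_of_neg] <;> linarith
    · rw [abs_of_neg] <;> linarith

/-- A free segment that crosses all walls away from the frame passes through three gaps. -/
theorem near_solution_of_free {x₁ y₁ x₂ y₂ : ℝ} (hs : FreeSegment D n M x₁ y₁ x₂ y₂)
    (hx₁ : |x₁| < 116 * M) (hx₂ : |x₂| < 116 * M) (hy₁ : y₁ < -(64 * M)) (hy₂ : 64 * M < y₂) :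
    ∃ i j k, (1 ≤ i ∧ i ≤ n) ∧ (1 ≤ j ∧ j ≤ n) ∧ (1 ≤ k ∧ k ≤ n) ∧ |D i + D j + D k| < 1 := by
  have hM := h.one_le
  have hdy : 0 < y₂ - y₁ := by linarith
  -- The segment is the graph of a function of the height, with slope `c`.
  set c := (x₂ - x₁) / (y₂ - y₁) with hc
  have hfree : ∀ y, y₁ ≤ y → y ≤ y₂ → Free D n M (x₁ + (y - y₁) * c) y ∧
      |x₁ + (y - y₁) * c| ≤ 116 * M := by
    intro y h1 h2
    have h3 : 0 ≤ (y - y₁) / (y₂ - y₁) := div_nonneg (by linarith) hdy.le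
    have h4 : (y - y₁) / (y₂ - y₁) ≤ 1 := (div_le_one hdy).2 (by linarith)
    have hf := hs _ h3 h4
    have e : (y - y₁) / (y₂ - y₁) * (x₂ - x₁) = (y - y₁) * c := by rw [hc]; ring
    rw [div_mul_cancel₀ _ hdy.ne', e, add_sub_cancel] at hf
    refine ⟨hf, ?_⟩
    rw [← e]
    rw [abs_lt] at hx₁ hx₂
    rw [abs_le]
    constructor <;> nlinarith
  have hgap : ∀ y, |y| = 64 * M → ∃ k, (1 ≤ k ∧ k ≤ n) ∧ |x₁ + (y - y₁) * c - 8 * D k| ≤ 1 := by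
    intro y hy
    have := abs_le.1 hy.le
    obtain ⟨hf, hx⟩ := hfree y (by linarith) (by linarith)
    obtain ⟨k, hk, hg⟩ := h.gap_of_free hf hy
    refine ⟨k, ⟨?_, ?_⟩, hg⟩
    · by_contra hk0
      obtain rfl : k = 0 := by omega
      rw [h.first] at hg
      linarith [(abs_le.1 hx).1, (abs_le.1 hg).2]
    · by_contra hkn
      obtain rfl : k = n + 1 := by omega
      rw [h.last] at hg
      linarith [(abs_le.1 hx).2, (abs_le.1 hg).1]
  obtain ⟨i, hi, hgi⟩ := hgap (-(64 * M)) (by rw [abs_neg, abs_of_pos]; linarith)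
  obtain ⟨j, hj, hgj⟩ := hgap (64 * M) (by rw [abs_of_pos]; linarith)
  have hbi := abs_le.1 (h.bound i hi.1 hi.2)
  have hbj := abs_le.1 (h.bound j hj.1 hj.2)
  rw [abs_le] at hgi hgj
  obtain ⟨k, hk1, hkn, hgk⟩ := h.middle_gap_of_free (hfree 0 (by linarith) (by linarith)).1
    (abs_le.2 ⟨by linarith, by linarith⟩)
  rw [abs_le] at hgk
  exact ⟨i, j, k, hi, hj, ⟨hk1, hkn⟩, abs_lt.2 ⟨by linarith, by linarith⟩⟩

/-- The segment through the three gaps of a solution is free. -/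
theorem freeSegment_of_solution {i j k : ℕ} (hi : 1 ≤ i ∧ i ≤ n) (hj : 1 ≤ j ∧ j ≤ n)
    (hk : 1 ≤ k ∧ k ≤ n) (hsum : D i + D j + D k = 0) {c : ℝ}
    (hc : c * (64 * M) = 4 * (D j - D i)) :
    FreeSegment D n M (-(4 * D k) - c * (64 * M + 2)) (-(64 * M + 2))
      (-(4 * D k) + c * (64 * M + 2)) (64 * M + 2) := by
  have hM := h.one_le
  have hbi := abs_le.1 (h.bound i hi.1 hi.2)
  have hbj := abs_le.1 (h.bound j hj.1 hj.2)
  have hbk := abs_le.1 (h.bound k hk.1 hk.2)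
  have hc8 : |c| ≤ 1 / 8 := by
    rw [abs_le]
    constructor <;> nlinarith
  have hcy : ∀ t : ℝ, |t| ≤ 2 → |c * t| ≤ 1 / 4 := by
    intro t ht
    rw [abs_mul]
    nlinarith [abs_nonneg c, abs_nonneg t]
  have split : ∀ a l : ℕ, a ≤ n → 1 ≤ l → l ≤ n → D l ≤ D a ∨ D (a + 1) ≤ D l := by
    intro a l ha h1 h2
    rcases le_or_gt l a with hl | hl
    · exact Or.inl (h.le_of_le hl (by omega))
    · exact Or.inr (h.le_of_le hl (by omega))
  intro θ h0 h1
  set y := -(64 * M + 2) + θ * (64 * M + 2 - -(64 * M + 2)) with hy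
  have hyl : -(64 * M + 2) ≤ y := by
    have : 0 ≤ θ * (64 * M + 2 - -(64 * M + 2)) := mul_nonneg h0 (by linarith)
    linarith
  have hyu : y ≤ 64 * M + 2 := by
    have : (1 - θ) * (64 * M + 2 - -(64 * M + 2)) ≥ 0 := mul_nonneg (by linarith) (by linarith)
    linarith
  rw [show -(4 * D k) - c * (64 * M + 2) + θ * (-(4 * D k) + c * (64 * M + 2) -
    (-(4 * D k) - c * (64 * M + 2))) = -(4 * D k) + c * y by rw [hy]; ring]
  have hx : |-(4 * D k) + c * y| ≤ 13 * M := by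
    have : |c * y| ≤ 9 * M := by
      rw [abs_mul]
      have : |y| ≤ 64 * M + 2 := abs_le.2 ⟨by linarith, by linarith⟩
      nlinarith [abs_nonneg c, abs_nonneg y]
    rw [abs_le] at this ⊢
    constructor <;> linarith
  refine ⟨by linarith, abs_le.2 ⟨by linarith, by linarith⟩, fun a ha ha1 ha2 hy1 hy2 => ?_,
    fun a ha ha1 ha2 hy1 => ?_, fun hx1 _ _ _ => by linarith⟩
  · rcases abs_cases y with ⟨e, -⟩ | ⟨e, -⟩ <;> rw [e] at hy1 hy2
    · have := abs_le.1 (hcy (y - 64 * M) (abs_le.2 ⟨by linarith, by linarith⟩))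
      rcases split a j ha hj.1 hj.2 with hs | hs <;> linarith
    · have := abs_le.1 (hcy (y + 64 * M) (abs_le.2 ⟨by linarith, by linarith⟩))
      rcases split a i ha hi.1 hi.2 with hs | hs <;> linarith
  · have := abs_le.1 (hcy y (by linarith))
    rcases split a k ha hk.1 hk.2 with hs | hs <;> linarith

/-- The corridor in front of the outer walls is free between the blockers. -/
theorem freeSegment_corridor {x y : ℝ} (hx : |x| ≤ 16 * M) (hy : |y| = 64 * M + 2) :
    FreeSegment D n M (-(16 * M)) y x y := by
  have hM := h.one_le
  intro θ h0 h1
  rw [sub_self, mul_zero, add_zero]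
  have : |-(16 * M) + θ * (x - -(16 * M))| ≤ 16 * M := by
    rw [abs_le] at hx ⊢
    constructor <;> nlinarith
  refine ⟨by linarith, by linarith, fun k _ _ _ _ _ => by linarith, fun k _ _ _ _ => by linarith,
    fun _ _ _ _ => by linarith⟩

/-- The source: the middle of the left end of the lower corridor. -/
def source (M : ℝ) : Plane := (-(16 * M), -(64 * M + 2))

/-- The target: the middle of the left end of the upper corridor. -/
def target (M : ℝ) : Plane := (-(16 * M), 64 * M + 2)

/-- The first and the last link stay in the corridors, so the middle link passes through a gap of
each wall.  Since the heights of the walls are equidistant and the gaps narrow, this determines the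
sum of the three numbers up to an error below `1`, and for integers exactly. -/
theorem hasLinkPath_iff (hint : ∀ k, 1 ≤ k → k ≤ n → ∃ z : ℤ, D k = z) :
    h.domain.HasLinkPath (source M) (target M) 3 ↔
      ∃ i j k, (1 ≤ i ∧ i ≤ n) ∧ (1 ≤ j ∧ j ≤ n) ∧ (1 ≤ k ∧ k ≤ n) ∧ D i + D j + D k = 0 := by
  have hM := h.one_le
  simp only [PolygonalDomain.HasLinkPath, h.segment_subset_carrier]
  constructor
  · rintro ⟨v, hv0, hv3, hv⟩
    have s0 := hv 0 (by norm_num)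
    have s1 := hv 1 (by norm_num)
    have s2 := (hv 2 (by norm_num)).reverse.reflect
    simp only [zero_add, Nat.reduceAdd, hv0, hv3, source, target] at s0 s1 s2
    obtain ⟨i, j, k, hi, hj, hk, hlt⟩ := h.near_solution_of_free s1 (h.link_stays_central s0)
      (h.link_stays_central s2) (h.link_stays_low s0) (by linarith [h.link_stays_low s2])
    refine ⟨i, j, k, hi, hj, hk, ?_⟩
    obtain ⟨a, ha⟩ := hint i hi.1 hi.2
    obtain ⟨b, hb⟩ := hint j hj.1 hj.2
    obtain ⟨c, hc⟩ := hint k hk.1 hk.2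
    rw [ha, hb, hc] at hlt ⊢
    exact_mod_cast Int.abs_lt_one_iff.1 (by exact_mod_cast hlt)
  · rintro ⟨i, j, k, hi, hj, hk, hsum⟩
    set c := 4 * (D j - D i) / (64 * M) with hc
    have hc' : c * (64 * M) = 4 * (D j - D i) := by rw [hc]; field_simp
    have hs := h.freeSegment_of_solution hi hj hk hsum hc'
    have hbi := abs_le.1 (h.bound i hi.1 hi.2)
    have hbj := abs_le.1 (h.bound j hj.1 hj.2)
    have hbk := abs_le.1 (h.bound k hk.1 hk.2)
    have hc1 : |c| ≤ 1 := by
      rw [abs_le]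
      constructor <;> nlinarith
    rw [abs_le] at hc1
    have f0 := h.freeSegment_corridor (x := -(4 * D k) - c * (64 * M + 2)) (y := -(64 * M + 2))
      (abs_le.2 ⟨by linarith, by linarith⟩) (by rw [abs_neg, abs_of_pos]; linarith)
    have f2 := (h.freeSegment_corridor (x := -(4 * D k) + c * (64 * M + 2)) (y := 64 * M + 2)
      (abs_le.2 ⟨by linarith, by linarith⟩) (by rw [abs_of_pos]; linarith)).reverse
    refine ⟨fun m => match m with
      | 0 => source M
      | 1 => (-(4 * D k) - c * (64 * M + 2), -(64 * M + 2))
      | 2 => (-(4 * D k) + c * (64 * M + 2), 64 * M + 2)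
      | _ => target M, rfl, rfl, fun m hm => ?_⟩
    interval_cases m
    exacts [f0, hs, f2]

end Framed

/-! ### The instance and its encoding -/

namespace Framed

variable {D : ℕ → ℝ} {n : ℕ} {M : ℝ} (h : Framed D n M)
include h

theorem source_mem_carrier : source M ∈ h.domain.carrier := by
  have hM := h.one_le
  refine h.mem_carrier_domain.2 ?_
  simpa using h.freeSegment_corridor (x := 0) (y := -(64 * M + 2)) (by simp; linarith)
    (by rw [abs_neg, abs_of_pos]; linarith) 0 le_rfl zero_le_one

theorem target_mem_carrier : target M ∈ h.domain.carrier := by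
  have hM := h.one_le
  refine h.mem_carrier_domain.2 ?_
  simpa using h.freeSegment_corridor (x := 0) (y := 64 * M + 2) (by simp; linarith)
    (by rw [abs_of_pos]; linarith) 0 le_rfl zero_le_one

omit h in
/-- The instance of the minimum-link path problem that belongs to a framed sequence. -/
noncomputable def linkInstance (h : Framed D n M) : LinkInstance where
  domain := h.domain
  s := source M
  t := target M
  s_mem := h.source_mem_carrier
  t_mem := h.target_mem_carrier

theorem holes_ne_nil : h.linkInstance.domain.holes ≠ [] := by
  simp [linkInstance, domain, holeBoxes, blockers]

theorem isRectilinear : h.linkInstance.domain.IsRectilinear := by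
  refine ⟨Box.isRectilinear_polygon, fun H hH => ?_⟩
  obtain ⟨b, -, rfl⟩ := List.mem_map.1 hH
  exact Box.isRectilinear_polygon

theorem numVertices : h.linkInstance.domain.numVertices = 12 * n + 32 := by
  have h1 : (SimplePolygon.n ∘ Box.polygon) = fun _ => 4 := funext fun _ => Box.polygon_n
  have h2 : (holeBoxes D n M).length = 3 * n + 7 := by
    simp [holeBoxes, blockers, wallBoxes, List.length_flatMap]
    ring
  simp only [PolygonalDomain.numVertices, linkInstance, domain, List.map_map, h1, Box.polygon_n,
    List.map_const', List.sum_replicate, h2, smul_eq_mul]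
  ring

/-- The part of the encoding that depends on the bound only. -/
noncomputable def header (M : ℝ) : List ℝ :=
  [-(16 * M), -(64 * M + 2), -(16 * M), 64 * M + 2] ++
    ((frameBox M).code ++ (blockers M).flatMap Box.code)

theorem encode_linkInstance : h.linkInstance.encode = header M ++
    (List.range (n + 1)).flatMap fun k => (wallBoxes M (D k) (D (k + 1))).flatMap Box.code := by
  have h1 : ((holeBoxes D n M).map Box.polygon).map SimplePolygon.encode =
      (holeBoxes D n M).map Box.code := by
    rw [List.map_map]
    exact List.map_congr_left fun b hb => Box.encode_polygon (h.nondegenerate_holeBoxes hb)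
  simp only [LinkInstance.encode, linkInstance, domain, h1,
    Box.encode_polygon h.nondegenerate_frameBox, header, source, target, List.append_assoc]
  rw [← List.flatMap_def, holeBoxes, List.flatMap_append, List.flatMap_assoc]

end Framed

/-- The link distance is at most `k` exactly if there is a path with `k` links, since paths can be
prolonged by trivial links. -/
theorem PolygonalDomain.linkDist_le_iff {P : PolygonalDomain} {s t : Plane} (ht : t ∈ P.carrier)
    (k : ℕ) : P.linkDist s t ≤ k ↔ P.HasLinkPath s t k := by
  constructor
  · intro h
    have h' : P.linkDist s t < (k + 1 : ℕ) := h.trans_lt (by exact_mod_cast Nat.lt_succ_self k)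
    simp only [linkDist, iInf_lt_iff, Nat.cast_lt] at h'
    obtain ⟨m, ⟨v, h0, hm, hv⟩, hmk⟩ := h'
    refine ⟨fun i => v (min i m), by simpa using h0, ?_, fun i _ => ?_⟩
    · dsimp only
      rw [min_eq_right (by omega), hm]
    · dsimp only
      rcases lt_or_ge i m with hi | hi
      · rw [min_eq_left hi.le, min_eq_left (by omega : i + 1 ≤ m)]
        exact hv i hi
      · rw [min_eq_right hi, min_eq_right (by omega : m ≤ i + 1), hm, segment_same]
        exact Set.singleton_subset_iff.2 ht
  · exact fun h => iInf₂_le k h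

/-! ### Verification of machine programs -/

namespace RealRAM

/-- From the store `σ`, the program `c` halts without queries, within `T` steps, in a store that
satisfies `Q`. -/
def Runs (O : List ℝ → ℕ) (c : Cmd) (σ : Store) (T : ℕ) (Q : Store → Prop) : Prop :=
  ∃ σ' t, Exec O c σ σ' t [] ∧ t ≤ T ∧ Q σ'

namespace Runs

variable {O : List ℝ → ℕ} {c d : Cmd} {b : Test} {σ : Store} {T T' : ℕ} {Q R : Store → Prop}

theorem mono (h : Runs O c σ T Q) (hT : T ≤ T') (hQ : ∀ τ, Q τ → R τ) : Runs O c σ T' R := by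
  obtain ⟨σ', t, he, ht, hq⟩ := h
  exact ⟨σ', t, he, ht.trans hT, hQ _ hq⟩

theorem seq (hc : Runs O c σ T Q) (hd : ∀ τ, Q τ → Runs O d τ T' R) :
    Runs O (.seq c d) σ (T + T') R := by
  obtain ⟨σ', t, he, ht, hq⟩ := hc
  obtain ⟨σ'', t', he', ht', hr⟩ := hd σ' hq
  exact ⟨σ'', t + t', .seq he he', Nat.add_le_add ht ht', hr⟩

theorem skip (h : Q σ) : Runs O .skip σ 0 Q := ⟨σ, 0, .skip σ, le_rfl, h⟩

theorem putNat {a : ℕ} {i e : NExp} (h : Q (σ.setNat a (i.eval σ) (e.eval σ))) :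
    Runs O (.putNat a i e) σ 1 Q :=
  ⟨_, 1, .putNat a i e σ, le_rfl, h⟩

theorem putReal {a : ℕ} {i : NExp} {e : RExp} (h : Q (σ.setReal a (i.eval σ) (e.eval σ))) :
    Runs O (.putReal a i e) σ 1 Q :=
  ⟨_, 1, .putReal a i e σ, le_rfl, h⟩

/-- An assignment followed by further commands. -/
theorem putNat_seq {a : ℕ} {i e : NExp}
    (h : Runs O d (σ.setNat a (i.eval σ) (e.eval σ)) T Q) :
    Runs O (.seq (.putNat a i e) d) σ (T + 1) Q :=
  ((putNat (Q := (· = _)) rfl).seq fun _ hτ => hτ ▸ h).mono (by omega) fun _ => id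

theorem putReal_seq {a : ℕ} {i : NExp} {e : RExp}
    (h : Runs O d (σ.setReal a (i.eval σ) (e.eval σ)) T Q) :
    Runs O (.seq (.putReal a i e) d) σ (T + 1) Q :=
  ((putReal (Q := (· = _)) rfl).seq fun _ hτ => hτ ▸ h).mono (by omega) fun _ => id

theorem ite (ht : b.holds σ → Runs O c σ T Q) (hf : ¬ b.holds σ → Runs O d σ T Q) :
    Runs O (.ite b c d) σ (T + 1) Q := by
  by_cases hb : b.holds σ
  · obtain ⟨σ', t, he, ht, hq⟩ := ht hb
    exact ⟨σ', t + 1, .ite_true hb he, by omega, hq⟩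
  · obtain ⟨σ', t, he, ht, hq⟩ := hf hb
    exact ⟨σ', t + 1, .ite_false hb he, by omega, hq⟩

/-- A loop with invariant `I`, indexed by the number of rounds done, that makes `N` rounds, the
`m`-th in at most `F m` steps. -/
theorem whileLoop {N : ℕ} {F : ℕ → ℕ} {I : ℕ → Store → Prop}
    (hcont : ∀ m τ, m < N → I m τ → b.holds τ)
    (hbody : ∀ m τ, m < N → I m τ → Runs O c τ (F m) (I (m + 1)))
    (hexit : ∀ τ, I N τ → ¬ b.holds τ) (h0 : I 0 σ) :
    Runs O (.while b c) σ (∑ m ∈ Finset.range N, (F m + 1) + 1) (I N) := by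
  have key : ∀ k m τ, m + k = N → I m τ →
      Runs O (.while b c) τ (∑ m ∈ Finset.Ico m N, (F m + 1) + 1) (I N) := by
    intro k
    induction k with
    | zero =>
      rintro m τ rfl hI
      exact ⟨τ, 1, .while_false (hexit τ hI), by simp, hI⟩
    | succ k ih =>
      intro m τ hm hI
      have hlt : m < N := by omega
      obtain ⟨σ', t, he, ht, hq⟩ := hbody m τ hlt hI
      obtain ⟨σ'', t', he', ht', hr⟩ := ih (m + 1) σ' (by omega) hq
      refine ⟨σ'', t + t' + 1, .while_true (hcont m τ hlt hI) he he', ?_, hr⟩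
      rw [Finset.sum_eq_sum_Ico_succ_bot hlt]
      omega
  have := key N 0 σ (by omega) h0
  rwa [Nat.Ico_zero_eq_range] at this

/-- A loop whose rounds take bounded time. -/
theorem while_const {N F : ℕ} {I : ℕ → Store → Prop}
    (hcont : ∀ m τ, m < N → I m τ → b.holds τ)
    (hbody : ∀ m τ, m < N → I m τ → Runs O c τ F (I (m + 1)))
    (hexit : ∀ τ, I N τ → ¬ b.holds τ) (h0 : I 0 σ) :
    Runs O (.while b c) σ (N * (F + 1) + 1) (I N) := by
  simpa using Runs.whileLoop (F := fun _ => F) hcont hbody hexit h0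

end Runs

section
variable (σ : Store) (a i v b j : ℕ) (x : ℝ)

@[simp]
theorem setNat_nat : (σ.setNat a i v).nat b j = if b = a ∧ j = i then v else σ.nat b j := by
  simp only [Store.setNat, Function.update_apply]
  grind [Function.update_apply]

@[simp]
theorem setNat_real : (σ.setNat a i v).real = σ.real := rfl

@[simp]
theorem setReal_real :
    (σ.setReal a i x).real b j = if b = a ∧ j = i then x else σ.real b j := by
  simp only [Store.setReal, Function.update_apply]
  grind [Function.update_apply]

@[simp]
theorem setReal_nat : (σ.setReal a i x).nat = σ.nat := rfl

end

/-- Store a list of expressions in consecutive cells of the real array `a`, from cell `p + m` on. -/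
def putList (a : ℕ) (p : NExp) : ℕ → List RExp → Cmd
  | _, [] => .skip
  | m, e :: es => .seq (.putReal a (.add p (.const m)) e) (putList a p (m + 1) es)

/-- The expression does not read the real array `a`. -/
def RExp.Avoids (a : ℕ) : RExp → Prop
  | .const _ => True
  | .get b _ => b ≠ a
  | .add e f => e.Avoids a ∧ f.Avoids a
  | .sub e f => e.Avoids a ∧ f.Avoids a
  | .mul e f => e.Avoids a ∧ f.Avoids a
  | .div e f => e.Avoids a ∧ f.Avoids a

theorem NExp.eval_congr {σ τ : Store} (h : τ.nat = σ.nat) (e : NExp) : e.eval τ = e.eval σ := by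
  induction e <;> simp_all [NExp.eval]

theorem RExp.Avoids.eval_congr {a : ℕ} {e : RExp} (he : e.Avoids a) {σ τ : Store}
    (h : τ.nat = σ.nat) (hr : ∀ b ≠ a, τ.real b = σ.real b) : e.eval τ = e.eval σ := by
  induction e with
  | const k => rfl
  | get b i => simp only [RExp.eval, NExp.eval_congr h, hr b he]
  | add e f ihe ihf => simp only [RExp.eval, ihe he.1, ihf he.2]
  | sub e f ihe ihf => simp only [RExp.eval, ihe he.1, ihf he.2]
  | mul e f ihe ihf => simp only [RExp.eval, ihe he.1, ihf he.2]
  | div e f ihe ihf => simp only [RExp.eval, ihe he.1, ihf he.2]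

theorem slice_succ (σ : Store) (a k : ℕ) : σ.slice a (k + 1) = σ.slice a k ++ [σ.real a k] := by
  simp [Store.slice, List.range_succ]

/-- Appending the values of expressions to an output array. -/
theorem runs_putList {O : List ℝ → ℕ} {a : ℕ} {p : NExp} {es : List RExp}
    (hes : ∀ e ∈ es, e.Avoids a) (m : ℕ) (σ : Store) :
    Runs O (putList a p m es) σ es.length fun τ => τ.nat = σ.nat ∧
      (∀ b ≠ a, τ.real b = σ.real b) ∧
      τ.slice a (p.eval σ + m + es.length) =
        σ.slice a (p.eval σ + m) ++ es.map (RExp.eval σ) := by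
  induction es generalizing m σ with
  | nil => exact .skip ⟨rfl, fun _ _ => rfl, by simp⟩
  | cons e es ih =>
    refine .putReal_seq ((ih (fun e he => hes e (List.mem_cons_of_mem _ he)) (m + 1) _).mono le_rfl
      ?_)
    rintro τ ⟨h1, h2, h3⟩
    set σ' := σ.setReal a ((p.add (.const m)).eval σ) (e.eval σ) with hσ'
    have hn : σ'.nat = σ.nat := rfl
    have hr : ∀ b ≠ a, σ'.real b = σ.real b := fun b hb => by
      funext j
      simp [hσ', hb]
    refine ⟨h1, fun b hb => (h2 b hb).trans (hr b hb), ?_⟩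
    rw [NExp.eval_congr hn] at h3
    have hs : σ'.slice a (p.eval σ + (m + 1)) = σ.slice a (p.eval σ + m) ++ [e.eval σ] := by
      rw [← add_assoc, slice_succ]
      congr 1
      · refine List.map_congr_left fun j hj => ?_
        rw [List.mem_range] at hj
        simp [hσ', NExp.eval, hj.ne]
      · simp [hσ', NExp.eval]
    have he : es.map (RExp.eval σ') = es.map (RExp.eval σ) :=
      List.map_congr_left fun f hf =>
        (hes f (List.mem_cons_of_mem _ hf)).eval_congr hn hr
    rw [hs, he] at h3
    rw [List.length_cons, show p.eval σ + m + (es.length + 1) = p.eval σ + (m + 1) + es.length by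
      ring, h3]
    simp

end RealRAM

/-! ### Sorting by a queue of runs -/

/-- The state of a merge of the sorted runs `[s₀, s₁)` and `[s₁, s₂)` of the tape `A` into a new run
that begins at `s₀ + n`: the cells up to `i` and `j` have been moved, and the next one is moved to
cell `k`.  The cells in use hold the entries of `L`. -/
structure Merging (L : List ℝ) (n s₀ s₁ s₂ : ℕ) (A : ℕ → ℝ) (i j k : ℕ) : Prop where
  le_i : s₀ ≤ i
  i_le : i ≤ s₁
  le_j : s₁ ≤ j
  j_le : j ≤ s₂
  le_tail : s₂ ≤ s₀ + n
  count : k + s₁ = i + j + n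
  mem : ∀ v, v ∈ L ↔ ∃ q, (i ≤ q ∧ q < s₁ ∨ j ≤ q ∧ q < k) ∧ A q = v
  left : ∀ p q, i ≤ p → p ≤ q → q < s₁ → A p ≤ A q
  right : ∀ p q, j ≤ p → p ≤ q → q < s₂ → A p ≤ A q
  out : ∀ p q, s₀ + n ≤ p → p ≤ q → q < k → A p ≤ A q
  out_left : ∀ p, s₀ + n ≤ p → p < k → i < s₁ → A p ≤ A i
  out_right : ∀ p, s₀ + n ≤ p → p < k → j < s₂ → A p ≤ A j

namespace Merging

variable {L : List ℝ} {n s₀ s₁ s₂ : ℕ} {A : ℕ → ℝ} {i j k : ℕ}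

theorem move_left (h : Merging L n s₀ s₁ s₂ A i j k) (hi : i < s₁)
    (hij : j < s₂ → A i ≤ A j) :
    Merging L n s₀ s₁ s₂ (Function.update A k (A i)) (i + 1) j (k + 1) := by
  obtain ⟨h1, h2, h3, h4, h5, h6, hm, hl, hr, ho, hol, hor⟩ := h
  have hne : ∀ q, q < k → Function.update A k (A i) q = A q := fun q hq =>
    Function.update_of_ne hq.ne _ _
  have hself : Function.update A k (A i) k = A i := Function.update_self ..
  refine ⟨by omega, hi, h3, h4, h5, by omega, fun v => ?_, ?_, ?_, ?_, ?_, ?_⟩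
  · rw [hm]
    constructor
    · rintro ⟨q, hq, rfl⟩
      by_cases hqi : q = i
      · exact ⟨k, by omega, by rw [hself, hqi]⟩
      · exact ⟨q, by omega, hne q (by omega)⟩
    · rintro ⟨q, hq, rfl⟩
      by_cases hqk : q = k
      · exact ⟨i, by omega, by rw [hqk, hself]⟩
      · exact ⟨q, by omega, (hne q (by omega)).symm⟩
  · intro p q hp hpq hq
    rw [hne p (by omega), hne q (by omega)]
    exact hl p q (by omega) hpq hq
  · intro p q hp hpq hq
    rw [hne p (by omega), hne q (by omega)]
    exact hr p q hp hpq hq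
  · intro p q hp hpq hq
    by_cases hqk : q = k
    · by_cases hpk : p = k
      · rw [hqk, hpk]
      · rw [hqk, hself, hne p (by omega)]
        exact hol p hp (by omega) hi
    · rw [hne p (by omega), hne q (by omega)]
      exact ho p q hp hpq (by omega)
  · intro p hp hpk hi'
    rw [hne (i + 1) (by omega)]
    refine le_trans ?_ (hl i (i + 1) le_rfl (by omega) hi')
    by_cases hpk' : p = k
    · rw [hpk', hself]
    · rw [hne p (by omega)]
      exact hol p hp (by omega) hi
  · intro p hp hpk hj
    rw [hne j (by omega)]
    by_cases hpk' : p = k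
    · rw [hpk', hself]
      exact hij hj
    · rw [hne p (by omega)]
      exact hor p hp (by omega) hj

theorem move_right (h : Merging L n s₀ s₁ s₂ A i j k) (hj : j < s₂)
    (hij : i < s₁ → A j ≤ A i) :
    Merging L n s₀ s₁ s₂ (Function.update A k (A j)) i (j + 1) (k + 1) := by
  obtain ⟨h1, h2, h3, h4, h5, h6, hm, hl, hr, ho, hol, hor⟩ := h
  have hne : ∀ q, q < k → Function.update A k (A j) q = A q := fun q hq =>
    Function.update_of_ne hq.ne _ _
  have hself : Function.update A k (A j) k = A j := Function.update_self ..
  refine ⟨h1, h2, by omega, hj, h5, by omega, fun v => ?_, ?_, ?_, ?_, ?_, ?_⟩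
  · rw [hm]
    constructor
    · rintro ⟨q, hq, rfl⟩
      by_cases hqj : q = j
      · exact ⟨k, by omega, by rw [hself, hqj]⟩
      · exact ⟨q, by omega, hne q (by omega)⟩
    · rintro ⟨q, hq, rfl⟩
      by_cases hqk : q = k
      · exact ⟨j, by omega, by rw [hqk, hself]⟩
      · exact ⟨q, by omega, (hne q (by omega)).symm⟩
  · intro p q hp hpq hq
    rw [hne p (by omega), hne q (by omega)]
    exact hl p q hp hpq hq
  · intro p q hp hpq hq
    rw [hne p (by omega), hne q (by omega)]
    exact hr p q (by omega) hpq hq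
  · intro p q hp hpq hq
    by_cases hqk : q = k
    · by_cases hpk : p = k
      · rw [hqk, hpk]
      · rw [hqk, hself, hne p (by omega)]
        exact hor p hp (by omega) hj
    · rw [hne p (by omega), hne q (by omega)]
      exact ho p q hp hpq (by omega)
  · intro p hp hpk hi
    rw [hne i (by omega)]
    by_cases hpk' : p = k
    · rw [hpk', hself]
      exact hij hi
    · rw [hne p (by omega)]
      exact hol p hp (by omega) hi
  · intro p hp hpk hj'
    rw [hne (j + 1) (by omega)]
    refine le_trans ?_ (hr j (j + 1) le_rfl (by omega) hj')
    by_cases hpk' : p = k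
    · rw [hpk', hself]
    · rw [hne p (by omega)]
      exact hor p hp (by omega) hj

end Merging

/-- The queue of sorted runs after `r` merges: the run number `m` occupies the cells
`[S m, S (m + 1))` of the tape `A`, the runs `2 r, …, n + r - 1` are waiting, and together they hold
the entries of `L`.  The last clause bounds the length of the run number `m` by
`(2 n - 1) / (2 n - 1 - m)`. -/
structure RunQueue (L : List ℝ) (n : ℕ) (A : ℕ → ℝ) (S : ℕ → ℕ) (r : ℕ) : Prop where
  mono : ∀ m < n + r, S m ≤ S (m + 1)
  tail : S (n + r) = S (2 * r) + n
  mem : ∀ v, v ∈ L ↔ ∃ q, (S (2 * r) ≤ q ∧ q < S (2 * r) + n) ∧ A q = v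
  sorted : ∀ m, 2 * r ≤ m → m < n + r → ∀ p q, S m ≤ p → p ≤ q → q < S (m + 1) → A p ≤ A q
  short : ∀ m, 2 * r ≤ m → m < n + r → (S (m + 1) - S m) * (2 * n - 1 - m) ≤ 2 * n - 1

namespace RunQueue

variable {L : List ℝ} {n : ℕ} {A A' : ℕ → ℝ} {S S' : ℕ → ℕ} {r : ℕ}

theorem le_of_le (h : RunQueue L n A S r) {l m : ℕ} (hlm : l ≤ m) (hm : m ≤ n + r) :
    S l ≤ S m := by
  induction m, hlm using Nat.le_induction with
  | base => rfl
  | succ m _ ih => exact (ih (by omega)).trans (h.mono m (by omega))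

theorem of_singletons (hA : ∀ v, v ∈ L ↔ ∃ q, q < n ∧ A q = v) (hS : ∀ m ≤ n, S m = m) :
    RunQueue L n A S 0 := by
  have hS0 : S 0 = 0 := hS 0 (by omega)
  refine ⟨fun m hm => ?_, ?_, fun v => ?_, fun m _ hm p q hp hpq hq => ?_, fun m _ hm => ?_⟩
  · rw [hS m (by omega), hS (m + 1) (by omega)]
    omega
  · simp [hS0, hS n le_rfl]
  · simp [hS0, hA]
  · rw [hS m (by omega)] at hp
    rw [hS (m + 1) (by omega)] at hq
    rw [show p = q by omega]
  · rw [hS m (by omega), hS (m + 1) (by omega), Nat.add_sub_cancel_left, one_mul]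
    omega

theorem merging (h : RunQueue L n A S r) (hr : r + 1 < n) :
    Merging L n (S (2 * r)) (S (2 * r + 1)) (S (2 * r + 2)) A (S (2 * r)) (S (2 * r + 1))
      (S (2 * r) + n) := by
  have h1 := h.mono (2 * r) (by omega)
  have h2 : S (2 * r + 1) ≤ S (2 * r + 2) := h.mono (2 * r + 1) (by omega)
  have h3 := h.le_of_le (show 2 * r + 2 ≤ n + r by omega) le_rfl
  rw [h.tail] at h3
  refine ⟨le_rfl, h1, le_rfl, h2, h3, by omega, fun v => ?_,
    h.sorted (2 * r) le_rfl (by omega), h.sorted (2 * r + 1) (by omega) (by omega),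
    fun _ _ _ _ _ => by omega, fun _ _ _ => by omega, fun _ _ _ => by omega⟩
  rw [h.mem]
  constructor
  · rintro ⟨q, hq, e⟩
    exact ⟨q, by omega, e⟩
  · rintro ⟨q, hq, e⟩
    exact ⟨q, by omega, e⟩

/-- The bound on the lengths of runs is inherited: from `l (2 m + 1) ≤ K` and `l' (2 m) ≤ K`
follows `(l + l') m ≤ K`. -/
theorem length_le (h : RunQueue L n A S r) (hr : r + 1 < n) :
    S (2 * r + 2) - S (2 * r) ≤ (2 * n - 1) / (n - 1 - r) := by
  obtain ⟨m, rfl⟩ : ∃ m, n = m + 1 + r := ⟨n - 1 - r, by omega⟩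
  have h1 := h.mono (2 * r) (by omega)
  have h2 : S (2 * r + 1) ≤ S (2 * r + 2) := h.mono (2 * r + 1) (by omega)
  have h3 := h.short (2 * r) (by omega) (by omega)
  have h4 := h.short (2 * r + 1) (by omega) (by omega)
  rw [Nat.le_div_iff_mul_le (by omega), show m + 1 + r - 1 - r = m by omega]
  rw [show 2 * (m + 1 + r) - 1 - 2 * r = 2 * m + 1 by omega] at h3
  rw [show 2 * (m + 1 + r) - 1 - (2 * r + 1) = 2 * m by omega] at h4
  obtain ⟨a, ha⟩ := Nat.exists_eq_add_of_le h1
  obtain ⟨b, hb⟩ := Nat.exists_eq_add_of_le h2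
  rw [ha, Nat.add_sub_cancel_left] at h3
  rw [hb, Nat.add_sub_cancel_left] at h4
  rw [hb, ha, show S (2 * r) + a + b - S (2 * r) = a + b by omega]
  nlinarith

theorem next (h : RunQueue L n A S r) (hr : r + 1 < n)
    (hM : Merging L n (S (2 * r)) (S (2 * r + 1)) (S (2 * r + 2)) A' (S (2 * r + 1))
      (S (2 * r + 2)) (S (2 * r + 2) + n))
    (hA : ∀ q < S (2 * r) + n, A' q = A q) (hS : ∀ m ≤ n + r, S' m = S m)
    (hS' : S' (n + r + 1) = S (2 * r + 2) + n) : RunQueue L n A' S' (r + 1) := by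
  have h1 := h.mono (2 * r) (by omega)
  have h2 : S (2 * r + 1) ≤ S (2 * r + 2) := h.mono (2 * r + 1) (by omega)
  have e : S' (2 * (r + 1)) = S (2 * r + 2) := hS _ (by omega)
  refine ⟨fun m hm => ?_, ?_, fun v => ?_, fun m hm1 hm2 p q hp hpq hq => ?_, fun m hm1 hm2 => ?_⟩
  · rcases eq_or_ne m (n + r) with rfl | hne
    · rw [hS', hS _ le_rfl, h.tail]
      omega
    · rw [hS _ (by omega), hS _ (by omega)]
      exact h.mono m (by omega)
  · rw [e, ← add_assoc, hS']
  · rw [e, hM.mem]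
    constructor
    · rintro ⟨q, hq, e⟩
      exact ⟨q, by omega, e⟩
    · rintro ⟨q, hq, e⟩
      exact ⟨q, by omega, e⟩
  · rcases eq_or_ne m (n + r) with rfl | hne
    · rw [hS _ le_rfl, h.tail] at hp
      rw [hS'] at hq
      exact hM.out p q hp hpq hq
    · rw [hS _ (by omega)] at hp
      rw [hS _ (by omega)] at hq
      have := h.le_of_le (show m + 1 ≤ n + r by omega) le_rfl
      rw [h.tail] at this
      rw [hA p (by omega), hA q (by omega)]
      exact h.sorted m (by omega) (by omega) p q hp hpq hq
  · rcases eq_or_ne m (n + r) with rfl | hne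
    · rw [hS', hS _ le_rfl, h.tail, Nat.add_sub_add_right]
      refine le_trans (Nat.mul_le_mul_right _ (h.length_le hr)) ?_
      rw [show 2 * n - 1 - (n + r) = n - 1 - r by omega]
      exact Nat.div_mul_le_self _ _
    · rw [hS _ (by omega), hS _ (by omega)]
      exact h.short m (by omega) (by omega)

end RunQueue

namespace RealRAM

/-- The register in cell `0` of the index array `a`. -/
def reg (a : ℕ) : NExp := .get a (.const 0)

/-- Assignment to the register in cell `0` of the index array `a`. -/
def setReg (a : ℕ) (e : NExp) : Cmd := .putNat a (.const 0) e

/-- Increase a register by a constant. -/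
def incReg (a k : ℕ) : Cmd := setReg a (.add (reg a) (.const k))

/-- Make every input number a run of its own. -/
def initRuns : Cmd :=
  .while (.natLt (reg 5) (.add (reg 0) (.const 1))) (.seq (.putNat 1 (reg 5) (reg 5)) (incReg 5 1))

/-- The start of the run number `2 r + m`, where `r` is the number of merges done. -/
def runStart (m : ℕ) : NExp := .get 1 (.add (.add (reg 2) (reg 2)) (.const m))

/-- Move the smaller one of the first entries of two runs to the end of the tape. -/
def moveSmaller : Cmd :=
  .seq
    (.ite (.and (.natLt (reg 3) (runStart 1))
        (.not (.and (.natLt (reg 4) (runStart 2)) (.realLt (.get 0 (reg 4)) (.get 0 (reg 3))))))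
      (.seq (.putReal 0 (reg 5) (.get 0 (reg 3))) (incReg 3 1))
      (.seq (.putReal 0 (reg 5) (.get 0 (reg 4))) (incReg 4 1)))
    (incReg 5 1)

/-- Merge the first two waiting runs into a new run at the end of the tape. -/
def mergeRuns : Cmd :=
  .seq (setReg 3 (runStart 0)) <| .seq (setReg 4 (runStart 1)) <|
  .seq (setReg 5 (.add (runStart 0) (reg 0))) <|
  .seq (.while (.natLt (reg 5) (.add (runStart 2) (reg 0))) moveSmaller) <|
  .seq (.putNat 1 (.add (.add (reg 0) (reg 2)) (.const 1)) (reg 5)) (incReg 2 1)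

/-- Merge until a single run is left. -/
def sortRuns : Cmd := .while (.natLt (.add (reg 2) (.const 1)) (reg 0)) mergeRuns

/-- The registers that sorting leaves alone: the number of inputs, and two that are still zero. -/
def Fresh (n : ℕ) (σ : Store) : Prop := σ.nat 0 0 = n ∧ σ.nat 6 0 = 0 ∧ σ.nat 7 0 = 0

variable {O : List ℝ → ℕ} {L : List ℝ} {n r : ℕ}

theorem setReal_real_self (σ : Store) (a i : ℕ) (x : ℝ) :
    (σ.setReal a i x).real a = Function.update (σ.real a) i x := by
  simp [Store.setReal]

theorem runs_initRuns (hL : L.length = n) :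
    Runs O initRuns (initStore L) (3 * (n + 1) + 1) fun σ =>
      Fresh n σ ∧ σ.nat 2 0 = 0 ∧ RunQueue L n (σ.real 0) (σ.nat 1) 0 := by
  refine (Runs.while_const (N := n + 1) (F := 2) (I := fun m σ => Fresh n σ ∧ σ.nat 2 0 = 0 ∧
    σ.nat 5 0 = m ∧ σ.real 0 = (initStore L).real 0 ∧ ∀ l < m, σ.nat 1 l = l) ?_ ?_ ?_ ?_).mono
    (by omega) ?_
  · rintro m σ hm ⟨⟨h0, -⟩, -, h5, -⟩
    simpa [Test.holds, NExp.eval, reg, h0, h5] using hm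
  · rintro m σ hm ⟨⟨h0, h6, h7⟩, h2, h5, hr, hs⟩
    refine Runs.putNat_seq (Runs.putNat ?_)
    refine ⟨⟨?_, ?_, ?_⟩, ?_, ?_, ?_, fun l hl => ?_⟩
    · simp [h0]
    · simp [h6]
    · simp [h7]
    · simp [h2]
    · simp [NExp.eval, reg, h5]
    · simp [hr]
    · rcases eq_or_ne l m with rfl | hne
      · simp [NExp.eval, reg, h5]
      · simp [NExp.eval, reg, h5, hne, hs l (by omega)]
  · rintro σ ⟨⟨h0, -⟩, -, h5, -⟩
    simp [Test.holds, NExp.eval, reg, h0, h5]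
  · simp [Fresh, initStore, hL]
  · rintro σ ⟨hf, h2, -, hr, hs⟩
    refine ⟨hf, h2, RunQueue.of_singletons (fun v => ?_) fun m hm => hs m (by omega)⟩
    rw [hr, List.mem_iff_getElem]
    simp only [initStore, if_true, ← hL]
    constructor
    · rintro ⟨q, hq, rfl⟩
      exact ⟨q, hq, List.getD_eq_getElem _ _ hq⟩
    · rintro ⟨q, hq, rfl⟩
      exact ⟨q, hq, (List.getD_eq_getElem _ _ hq).symm⟩

/-- The invariant of the loop of a merge, after `m` moves: `S` lists the starts of the runs, `A` is
the tape before the merge. -/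
def MergeInv (L : List ℝ) (n r : ℕ) (A : ℕ → ℝ) (S : ℕ → ℕ) (m : ℕ) (σ : Store) : Prop :=
  Fresh n σ ∧ σ.nat 2 0 = r ∧ σ.nat 1 = S ∧ (∀ q < S (2 * r) + n, σ.real 0 q = A q) ∧
    σ.nat 5 0 = S (2 * r) + n + m ∧
    Merging L n (S (2 * r)) (S (2 * r + 1)) (S (2 * r + 2)) (σ.real 0) (σ.nat 3 0) (σ.nat 4 0)
      (σ.nat 5 0)

theorem eval_runStart {σ : Store} {S : ℕ → ℕ} (h2 : σ.nat 2 0 = r) (hS : σ.nat 1 = S) (m : ℕ) :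
    (runStart m).eval σ = S (2 * r + m) := by
  simp [runStart, NExp.eval, reg, h2, hS, two_mul]

theorem runs_moveSmaller {A : ℕ → ℝ} {S : ℕ → ℕ} {m : ℕ} {σ : Store}
    (hm : m < S (2 * r + 2) - S (2 * r)) (h : MergeInv L n r A S m σ) :
    Runs O moveSmaller σ 4 (MergeInv L n r A S (m + 1)) := by
  obtain ⟨⟨h0, h6, h7⟩, h2, hS, hA, h5, hM⟩ := h
  refine Runs.seq (T := 3) (T' := 1) (Q := fun τ => Fresh n τ ∧ τ.nat 2 0 = r ∧ τ.nat 1 = S ∧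
    (∀ q < S (2 * r) + n, τ.real 0 q = A q) ∧ τ.nat 5 0 = S (2 * r) + n + m ∧
    Merging L n (S (2 * r)) (S (2 * r + 1)) (S (2 * r + 2)) (τ.real 0) (τ.nat 3 0) (τ.nat 4 0)
      (τ.nat 5 0 + 1)) (Runs.ite ?_ ?_) ?_
  · intro hb
    simp only [Test.holds, eval_runStart h2 hS, RExp.eval] at hb
    simp only [reg, NExp.eval] at hb
    refine Runs.putReal_seq (Runs.putNat ?_)
    refine ⟨⟨?_, ?_, ?_⟩, ?_, ?_, fun q hq => ?_, ?_, ?_⟩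
    · simp [h0]
    · simp [h6]
    · simp [h7]
    · simp [h2]
    · funext l
      simp [hS]
    · simp only [setNat_real, setReal_real, reg, NExp.eval, h5]
      rw [if_neg (by omega), hA q hq]
    · simp [h5]
    · have := hM.move_left hb.1 fun hj => not_lt.1 fun hlt => hb.2 ⟨hj, hlt⟩
      simpa [reg, NExp.eval, RExp.eval, setReal_real_self] using this
  · intro hb
    simp only [Test.holds, eval_runStart h2 hS, RExp.eval] at hb
    simp only [reg, NExp.eval] at hb
    refine Runs.putReal_seq (Runs.putNat ?_)
    refine ⟨⟨?_, ?_, ?_⟩, ?_, ?_, fun q hq => ?_, ?_, ?_⟩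
    · simp [h0]
    · simp [h6]
    · simp [h7]
    · simp [h2]
    · funext l
      simp [hS]
    · simp only [setNat_real, setReal_real, reg, NExp.eval, h5]
      rw [if_neg (by omega), hA q hq]
    · simp [h5]
    -- If the left run is exhausted, the right one is not, as the loop has not ended.
    · have hj : σ.nat 4 0 < S (2 * r + 2) := by
        by_contra hj
        have hc := hM.count
        have := hM.i_le
        have := hM.j_le
        rcases lt_or_ge (σ.nat 3 0) (S (2 * r + 1)) with hi | hi
        · exact hb ⟨hi, fun h => hj h.1⟩
        · omega
      have := hM.move_right hj fun hi => by
        by_contra! hlt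
        exact hb ⟨hi, fun h => absurd h.2 hlt.not_gt⟩
      simpa [reg, NExp.eval, RExp.eval, setReal_real_self] using this
  · rintro τ ⟨⟨h0, h6, h7⟩, h2, hS, hA, h5, hM⟩
    refine Runs.putNat ⟨⟨?_, ?_, ?_⟩, ?_, ?_, ?_, ?_, ?_⟩
    · simp [h0]
    · simp [h6]
    · simp [h7]
    · simp [h2]
    · funext l
      simp [hS]
    · simpa using hA
    · simp [reg, NExp.eval, h5, add_assoc]
    · simpa [reg, NExp.eval] using hM

theorem runs_mergeRuns {σ : Store} (hr : r + 1 < n) (hf : Fresh n σ) (h2 : σ.nat 2 0 = r)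
    (hQ : RunQueue L n (σ.real 0) (σ.nat 1) r) :
    Runs O mergeRuns σ (5 * ((2 * n - 1) / (n - 1 - r)) + 6) fun τ =>
      Fresh n τ ∧ τ.nat 2 0 = r + 1 ∧ RunQueue L n (τ.real 0) (τ.nat 1) (r + 1) := by
  obtain ⟨h0, h6, h7⟩ := hf
  have hlen := hQ.length_le hr
  set S := σ.nat 1 with hS
  have hM := hQ.merging hr
  have hle : S (2 * r) ≤ S (2 * r + 2) := hQ.le_of_le (by omega) (by omega)
  refine Runs.mono (T := (S (2 * r + 2) - S (2 * r)) * (4 + 1) + 1 + 2 + 1 + 1 + 1) ?_ (by omega)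
    fun _ => id
  refine Runs.putNat_seq (Runs.putNat_seq (Runs.putNat_seq (Runs.seq
    (T := (S (2 * r + 2) - S (2 * r)) * (4 + 1) + 1) (T' := 2) (Runs.while_const
    (I := MergeInv L n r (σ.real 0) S) (N := S (2 * r + 2) - S (2 * r)) (F := 4) ?_ ?_ ?_ ?_) ?_)))
  · rintro m τ hm ⟨⟨h0, -⟩, h2, hS, -, h5, -⟩
    simp only [Test.holds, NExp.eval, eval_runStart h2 hS, reg, h5, h0]
    omega
  · exact fun m τ hm hI => runs_moveSmaller hm hI
  · rintro τ ⟨⟨h0, -⟩, h2, hS, -, h5, -⟩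
    simp only [Test.holds, NExp.eval, eval_runStart h2 hS, reg, h5, h0]
    omega
  · have e0 := eval_runStart h2 hS.symm 0
    have e1 : ∀ x, (runStart 1).eval (σ.setNat 3 0 x) = S (2 * r + 1) := fun x =>
      eval_runStart (by simp [h2]) (by funext l; simp [hS]) 1
    have e2 : ∀ x y, (runStart 0).eval ((σ.setNat 3 0 x).setNat 4 0 y) = S (2 * r) := fun x y =>
      eval_runStart (by simp [h2]) (by funext l; simp [hS]) 0
    refine ⟨⟨?_, ?_, ?_⟩, ?_, ?_, ?_, ?_, ?_⟩
    · simp [h0]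
    · simp [h6]
    · simp [h7]
    · simp [h2]
    · funext l
      simp [hS]
    · simp
    · simp [NExp.eval, e2, reg, h0]
    · simpa [NExp.eval, e0, e1, e2, reg, h0] using hM
  · rintro τ ⟨⟨h0, h6, h7⟩, h2, hS', hA, h5, hM'⟩
    refine Runs.putNat_seq (Runs.putNat ?_)
    have hk : τ.nat 5 0 = S (2 * r + 2) + n := by omega
    have hi : τ.nat 3 0 = S (2 * r + 1) := by
      have := hM'.count
      have := hM'.i_le
      have := hM'.j_le
      omega
    have hj : τ.nat 4 0 = S (2 * r + 2) := by
      have := hM'.count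
      have := hM'.i_le
      have := hM'.j_le
      omega
    rw [hi, hj, hk] at hM'
    refine ⟨⟨?_, ?_, ?_⟩, ?_, ?_⟩
    · simp [h0]
    · simp [h6]
    · simp [h7]
    · simp [reg, NExp.eval, h2]
    · refine hQ.next hr hM' hA (fun m hm => ?_) ?_
      · simp only [reg, NExp.eval, setNat_nat, h0, h2, hS']
        rw [if_neg (by omega), if_neg (by omega)]
      · simp [reg, NExp.eval, h0, h2, hk]

/-- The outcome of sorting: the input in increasing order in consecutive cells of the tape. -/
def Sorted (L : List ℝ) (n : ℕ) (σ : Store) : Prop :=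
  Fresh n σ ∧ ∃ h, (runStart 0).eval σ = h ∧
    (∀ v, v ∈ L ↔ ∃ q < n, σ.real 0 (h + q) = v) ∧
    ∀ p q, p ≤ q → q < n → σ.real 0 (h + p) ≤ σ.real 0 (h + q)

theorem runs_sort (hL : L.length = n) :
    Runs O (.seq initRuns sortRuns) (initStore L)
      (3 * (n + 1) + 1 +
        (∑ r ∈ Finset.range (n - 1), (5 * ((2 * n - 1) / (n - 1 - r)) + 6 + 1) + 1))
      (Sorted L n) := by
  refine (runs_initRuns hL).seq fun σ hσ => ?_
  refine (Runs.whileLoop (I := fun r σ =>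
    Fresh n σ ∧ σ.nat 2 0 = r ∧ RunQueue L n (σ.real 0) (σ.nat 1) r) ?_ ?_ ?_ hσ).mono le_rfl ?_
  · rintro r τ hr ⟨⟨h0, -⟩, h2, -⟩
    simp only [Test.holds, NExp.eval, reg, h0, h2]
    omega
  · exact fun r τ hr ⟨hf, h2, hQ⟩ => runs_mergeRuns (by omega) hf h2 hQ
  · rintro τ ⟨⟨h0, -⟩, h2, -⟩
    simp only [Test.holds, NExp.eval, reg, h0, h2]
    omega
  · rintro τ ⟨hf, h2, hQ⟩
    refine ⟨hf, τ.nat 1 (2 * (n - 1)), eval_runStart h2 rfl 0, fun v => ?_, fun p q hpq hq => ?_⟩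
    · rw [hQ.mem]
      constructor
      · rintro ⟨q, hq, e⟩
        exact ⟨q - τ.nat 1 (2 * (n - 1)), by omega, by rw [← e]; congr 1; omega⟩
      · rintro ⟨q, hq, e⟩
        exact ⟨_, by omega, e⟩
    · have ht := hQ.tail
      refine hQ.sorted (2 * (n - 1)) le_rfl (by omega) _ _ (by omega) (by omega) ?_
      rw [show n + (n - 1) = 2 * (n - 1) + 1 by omega] at ht
      omega

end RealRAM

/-! ### Writing the instance -/

namespace RealRAM

/-- Copy the sorted numbers to the real array `2` from cell `1` on, and compute in the real array
`3` a bound `M` of their absolute values, one plus the sum of their squares.  Then write the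
sentinels `-16 M` and `16 M`. -/
def collect : Cmd :=
  .seq (.putReal 3 (.const 0) (.const 1)) <|
  .seq (.while (.natLt (reg 6) (reg 0)) <|
    .seq (.putReal 2 (.add (reg 6) (.const 1)) (.get 0 (.add (runStart 0) (reg 6)))) <|
    .seq (.putReal 3 (.const 0) (.add (.get 3 (.const 0))
      (.mul (.get 0 (.add (runStart 0) (reg 6))) (.get 0 (.add (runStart 0) (reg 6)))))) <|
    incReg 6 1) <|
  .seq (.putReal 2 (.const 0) (.mul (.const (-16)) (.get 3 (.const 0)))) <|
  .putReal 2 (.add (reg 0) (.const 1)) (.mul (.const 16) (.get 3 (.const 0)))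

/-- The numbers have been framed, and the loop counter in register `7` is still zero. -/
def Collected (L : List ℝ) (n : ℕ) (σ : Store) : Prop :=
  σ.nat 0 0 = n ∧ σ.nat 7 0 = 0 ∧ Framed (σ.real 2) n (σ.real 3 0) ∧
    ∀ v, v ∈ L ↔ ∃ k, 1 ≤ k ∧ k ≤ n ∧ σ.real 2 k = v

/-- A weakly increasing enumeration of `n` distinct integers by `n` indices has steps at least
`1`. -/
theorem add_one_le_of_sorted {l : List ℤ} (hl : l.Nodup) {n : ℕ} (hn : l.length = n) {f : ℕ → ℝ}
    (hmem : ∀ v, v ∈ l.map (fun a : ℤ => (a : ℝ)) ↔ ∃ q < n, f q = v)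
    (hf : ∀ p q, p ≤ q → q < n → f p ≤ f q) {q : ℕ} (hq : q + 1 < n) : f q + 1 ≤ f (q + 1) := by
  classical
  have himage : (Finset.range n).image f = (l.map (fun a : ℤ => (a : ℝ))).toFinset := by
    ext v
    rw [List.mem_toFinset, hmem]
    simp
  have hinj : Set.InjOn f (Finset.range n) := by
    rw [← Finset.card_image_iff, himage,
      List.toFinset_card_of_nodup (hl.map Int.cast_injective), List.length_map, hn,
      Finset.card_range]
  obtain ⟨a, -, ha⟩ := List.mem_map.1 ((hmem (f q)).2 ⟨q, by omega, rfl⟩)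
  obtain ⟨b, -, hb⟩ := List.mem_map.1 ((hmem (f (q + 1))).2 ⟨q + 1, hq, rfl⟩)
  have hne : f q ≠ f (q + 1) := fun e => by
    have := hinj (by simp; omega) (by simpa using hq) e
    omega
  have hlt : f q < f (q + 1) := lt_of_le_of_ne (hf _ _ (by omega) hq) hne
  rw [← ha, ← hb] at hlt ⊢
  exact_mod_cast Int.add_one_le_of_lt (by exact_mod_cast hlt)

variable {O : List ℝ → ℕ} {n : ℕ}

theorem runs_collect {l : List ℤ} (hl : l.Nodup) (hn : l.length = n) {σ : Store}
    (hσ : Sorted (l.map fun a : ℤ => (a : ℝ)) n σ) :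
    Runs O collect σ (4 * n + 4) (Collected (l.map fun a : ℤ => (a : ℝ)) n) := by
  obtain ⟨⟨h0, h6, h7⟩, h, hh, hmem, hsort⟩ := hσ
  set A := σ.real 0 with hA
  set S := σ.nat 1 with hS
  set r := σ.nat 2 0 with hr
  have hh' : S (2 * r + 0) = h := by rw [← hh, eval_runStart hr.symm hS.symm]
  refine Runs.mono (T := n * (3 + 1) + 1 + (1 + 1) + 1) ?_ (by omega) fun _ => id
  refine Runs.putReal_seq (Runs.seq (T := n * (3 + 1) + 1) (T' := 1 + 1) (Runs.while_const
    (I := fun m τ => τ.nat 0 0 = n ∧ τ.nat 6 0 = m ∧ τ.nat 7 0 = 0 ∧ τ.nat 1 = S ∧ τ.nat 2 0 = r ∧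
      τ.real 0 = A ∧ (∀ q < m, τ.real 2 (q + 1) = A (h + q)) ∧ 1 ≤ τ.real 3 0 ∧
      ∀ q < m, A (h + q) * A (h + q) + 1 ≤ τ.real 3 0) ?_ ?_ ?_ ?_) ?_)
  · rintro m τ hm ⟨h0, h6, -⟩
    simpa [Test.holds, NExp.eval, reg, h0, h6] using hm
  · rintro m τ hm ⟨h0, h6, h7, h1, h2, hA, hD, hM1, hM⟩
    have e : (runStart 0).eval τ = h := by rw [eval_runStart h2 h1, hh']
    have e' : ∀ a i x, (runStart 0).eval (τ.setReal a i x) = h := fun a i x => by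
      rw [eval_runStart (S := S) (by simpa using h2) (by simpa using h1), hh']
    refine Runs.putReal_seq (Runs.putReal_seq (Runs.putNat ?_))
    refine ⟨?_, ?_, ?_, ?_, ?_, ?_, fun q hq => ?_, ?_, fun q hq => ?_⟩
    · simp [h0]
    · simp [NExp.eval, reg, h6]
    · simp [h7]
    · funext l
      simp [h1]
    · simp [h2]
    · funext l
      simp [hA]
    · rcases eq_or_ne q m with rfl | hne
      · simp [NExp.eval, RExp.eval, reg, h6, e, hA]
      · simp [NExp.eval, reg, h6, hne, hD q (by omega)]
    · simp [NExp.eval, RExp.eval, reg, h6, e', hA]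
      nlinarith [mul_self_nonneg (A (h + m))]
    · rcases eq_or_ne q m with rfl | hne
      · simp [NExp.eval, RExp.eval, reg, h6, e', hA]
        linarith
      · simp [NExp.eval, RExp.eval, reg, h6, e', hA]
        nlinarith [mul_self_nonneg (A (h + m)), hM q (by omega)]
  · rintro τ ⟨h0, h6, -⟩
    simp [Test.holds, NExp.eval, reg, h0, h6]
  · refine ⟨?_, ?_, ?_, ?_, ?_, ?_, ?_, ?_, ?_⟩
    · simp [h0]
    · simp [h6]
    · simp [h7]
    · simp [hS]
    · simp [hr]
    · funext l
      simp [hA]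
    · simp
    · simp [NExp.eval, RExp.eval]
    · simp
  · rintro τ ⟨h0, -, h7, -, -, -, hD, hM1, hM⟩
    refine Runs.putReal_seq (Runs.putReal ?_)
    set τ' := (τ.setReal 2 ((NExp.const 0).eval τ)
      ((RExp.mul (.const (-16)) (.get 3 (.const 0))).eval τ)) with hτ'
    set M := τ.real 3 0 with hMdef
    set υ := (τ'.setReal 2 ((NExp.add (reg 0) (.const 1)).eval τ')
      ((RExp.mul (.const 16) (.get 3 (.const 0))).eval τ')) with hυ
    have uM : υ.real 3 0 = M := by simp [hυ, hτ', hMdef]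
    have u0 : υ.real 2 0 = -16 * M := by simp [hυ, hτ', NExp.eval, RExp.eval, reg, hMdef]
    have un : υ.real 2 (n + 1) = 16 * M := by simp [hυ, hτ', NExp.eval, RExp.eval, reg, h0, hMdef]
    have uk : ∀ q < n, υ.real 2 (q + 1) = A (h + q) := by
      intro q hq
      simp [hυ, hτ', NExp.eval, reg, h0, hq.ne, hD q hq]
    have hb : ∀ q < n, |A (h + q)| ≤ M := by
      intro q hq
      rw [abs_le]
      constructor <;> nlinarith [hM q hq, mul_self_nonneg (A (h + q) - 1),
        mul_self_nonneg (A (h + q) + 1), mul_self_nonneg (A (h + q))]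
    refine ⟨by simp [hυ, hτ', h0], by simp [hυ, hτ', h7], ?_, fun v => ?_⟩
    · rw [uM]
      refine ⟨hM1, u0, un, fun k hk => ?_, fun k hk1 hkn => ?_⟩
      · rcases Nat.eq_zero_or_pos k with rfl | hk0
        · rcases Nat.eq_zero_or_pos n with rfl | hn0
          · rw [u0, un]
            linarith
          · rw [u0, uk 0 hn0]
            linarith [(abs_le.1 (hb 0 hn0)).1]
        · obtain ⟨q, rfl⟩ : ∃ q, k = q + 1 := ⟨k - 1, by omega⟩
          rcases eq_or_ne (q + 1) n with hq | hq
          · rw [uk q (by omega), hq, un]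
            linarith [(abs_le.1 (hb q (by omega))).2]
          · rw [uk q (by omega), uk (q + 1) (by omega)]
            exact add_one_le_of_sorted hl hn hmem hsort (by omega)
      · obtain ⟨q, rfl⟩ : ∃ q, k = q + 1 := ⟨k - 1, by omega⟩
        rw [uk q (by omega)]
        exact hb q (by omega)
    · rw [hmem]
      constructor
      · rintro ⟨q, hq, e⟩
        exact ⟨q + 1, by omega, by omega, (uk q hq).trans e⟩
      · rintro ⟨k, hk1, hkn, e⟩
        obtain ⟨q, rfl⟩ : ∃ q, k = q + 1 := ⟨k - 1, by omega⟩
        exact ⟨q, by omega, (uk q (by omega)).symm.trans e⟩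

/-- The expression `(a e + b) / d`. -/
def linExp (a b d : ℤ) (e : RExp) : RExp := .div (.add (.mul (.const a) e) (.const b)) (.const d)

/-- Expressions for the description of a box. -/
def boxExps (x₁ x₂ y₁ y₂ : RExp) : List RExp := [.const 4, x₁, y₁, x₂, y₁, x₂, y₂, x₁, y₂]

/-- The bound computed by `collect`. -/
def boundExp : RExp := .get 3 (.const 0)

/-- Expressions for `Framed.header`. -/
def headerExps : List RExp :=
  [linExp (-16) 0 1 boundExp, linExp (-64) (-2) 1 boundExp, linExp (-16) 0 1 boundExp,
    linExp 64 2 1 boundExp] ++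
  (boxExps (linExp (-128) 0 1 boundExp) (linExp 128 0 1 boundExp) (linExp (-64) (-3) 1 boundExp)
    (linExp 64 3 1 boundExp) ++
  (boxExps (linExp (-116) 0 1 boundExp) (linExp (-16) 0 1 boundExp)
    (linExp (-128) (-5) 2 boundExp) (linExp (-128) (-3) 2 boundExp) ++
  (boxExps (linExp 16 0 1 boundExp) (linExp 116 0 1 boundExp)
    (linExp (-128) (-5) 2 boundExp) (linExp (-128) (-3) 2 boundExp) ++
  (boxExps (linExp (-116) 0 1 boundExp) (linExp (-16) 0 1 boundExp)
    (linExp 128 3 2 boundExp) (linExp 128 5 2 boundExp) ++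
  boxExps (linExp 16 0 1 boundExp) (linExp 116 0 1 boundExp)
    (linExp 128 3 2 boundExp) (linExp 128 5 2 boundExp)))))

/-- Expressions for the boxes of the walls between two consecutive numbers, for the position in
register `7`. -/
def wallExps : List RExp :=
  let a : RExp := .get 2 (reg 7)
  let b : RExp := .get 2 (.add (reg 7) (.const 1))
  boxExps (linExp 8 1 1 a) (linExp 8 (-1) 1 b) (linExp (-64) (-1) 1 boundExp)
    (linExp (-64) 1 1 boundExp) ++
  (boxExps (linExp (-4) 1 1 b) (linExp (-4) (-1) 1 a) (.const (-1)) (.const 1) ++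
  boxExps (linExp 8 1 1 a) (linExp 8 (-1) 1 b) (linExp 64 (-1) 1 boundExp)
    (linExp 64 1 1 boundExp))

theorem map_eval_boxExps {σ : Store} {x₁ x₂ y₁ y₂ : RExp} {b : Box} (h₁ : x₁.eval σ = b.x₁)
    (h₂ : x₂.eval σ = b.x₂) (h₃ : y₁.eval σ = b.y₁) (h₄ : y₂.eval σ = b.y₂) :
    (boxExps x₁ x₂ y₁ y₂).map (RExp.eval σ) = b.code := by
  simp [boxExps, Box.code, RExp.eval, h₁, h₂, h₃, h₄]

theorem eval_linExp {σ : Store} {e : RExp} {x : ℝ} (he : e.eval σ = x) (a b d : ℤ) :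
    (linExp a b d e).eval σ = (a * x + b) / d := by
  simp [linExp, RExp.eval, he]

theorem map_eval_headerExps {σ : Store} {M : ℝ} (hM : σ.real 3 0 = M) :
    headerExps.map (RExp.eval σ) = Framed.header M := by
  have e : boundExp.eval σ = M := hM
  simp only [headerExps, Framed.header, List.map_append, blockers, List.flatMap_cons,
    List.flatMap_nil, List.append_nil]
  refine congr_arg₂ _ ?_ (congr_arg₂ _ ?_ (congr_arg₂ _ ?_ (congr_arg₂ _ ?_ (congr_arg₂ _ ?_ ?_))))
  · simp only [List.map_cons, List.map_nil, eval_linExp e, List.cons.injEq, and_true]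
    push_cast
    refine ⟨?_, ?_, ?_, ?_⟩ <;> ring
  all_goals
    refine map_eval_boxExps ?_ ?_ ?_ ?_ <;> rw [eval_linExp e] <;> push_cast <;>
      (try simp only [frameBox]) <;> ring

theorem map_eval_wallExps {σ : Store} {D : ℕ → ℝ} {M : ℝ} {k : ℕ} (hD : σ.real 2 = D)
    (hM : σ.real 3 0 = M) (hk : σ.nat 7 0 = k) :
    wallExps.map (RExp.eval σ) = (wallBoxes M (D k) (D (k + 1))).flatMap Box.code := by
  have e : boundExp.eval σ = M := hM
  have ea : (RExp.get 2 (reg 7)).eval σ = D k := by simp [RExp.eval, NExp.eval, reg, hD, hk]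
  have eb : (RExp.get 2 (.add (reg 7) (.const 1))).eval σ = D (k + 1) := by
    simp [RExp.eval, NExp.eval, reg, hD, hk]
  simp only [wallExps, List.map_append, wallBoxes, List.flatMap_cons, List.flatMap_nil,
    List.append_nil]
  refine congr_arg₂ _ ?_ (congr_arg₂ _ ?_ ?_) <;> refine map_eval_boxExps ?_ ?_ ?_ ?_ <;>
    simp only [eval_linExp e, eval_linExp ea, eval_linExp eb, RExp.eval] <;> push_cast <;> ring

theorem avoids_headerExps : ∀ e ∈ headerExps, e.Avoids 1 := by
  simp [headerExps, boxExps, linExp, boundExp, RExp.Avoids]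

theorem avoids_wallExps : ∀ e ∈ wallExps, e.Avoids 1 := by
  simp [wallExps, boxExps, linExp, boundExp, RExp.Avoids]

/-- Write the encoding of the instance into the real array `1`, its length into register `5`. -/
def emit : Cmd :=
  .seq (putList 1 (.const 0) 0 headerExps) <|
  .seq (setReg 5 (.const 49)) <|
  .while (.natLt (reg 7) (.add (reg 0) (.const 1))) <|
    .seq (putList 1 (reg 5) 0 wallExps) <|
    .seq (incReg 5 27) (incReg 7 1)

theorem runs_emit {σ : Store} (h0 : σ.nat 0 0 = n) (h7 : σ.nat 7 0 = 0)
    (h : Framed (σ.real 2) n (σ.real 3 0)) :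
    Runs O emit σ (30 * n + 81) fun τ => τ.slice 1 (τ.nat 5 0) = h.linkInstance.encode := by
  set D := σ.real 2 with hD
  set M := σ.real 3 0 with hM
  refine Runs.mono (T := 49 + ((n + 1) * (29 + 1) + 1 + 1)) (Runs.seq
    (runs_putList avoids_headerExps 0 σ) ?_) (by omega) fun _ => id
  rintro τ ⟨hn, hr, hs⟩
  refine Runs.putNat_seq ((Runs.while_const (N := n + 1) (F := 29)
    (I := fun m τ => τ.nat 0 0 = n ∧ τ.nat 7 0 = m ∧ τ.nat 5 0 = 49 + 27 * m ∧ τ.real 2 = D ∧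
      τ.real 3 0 = M ∧ τ.slice 1 (τ.nat 5 0) = Framed.header M ++
        (List.range m).flatMap fun k => (wallBoxes M (D k) (D (k + 1))).flatMap Box.code)
    ?_ ?_ ?_ ?_).mono le_rfl ?_)
  · rintro m υ hm ⟨h0, h7, -⟩
    simpa [Test.holds, NExp.eval, reg, h0, h7] using hm
  · rintro m υ hm ⟨h0, h7, h5, hD, hM, hs⟩
    refine Runs.mono (T := 27 + (1 + 1)) (Runs.seq (runs_putList avoids_wallExps 0 υ) ?_) le_rfl
      fun _ => id
    rintro ω ⟨hn, hr, hs'⟩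
    refine Runs.putNat_seq (Runs.putNat ?_)
    refine ⟨?_, ?_, ?_, ?_, ?_, ?_⟩
    · simp [hn, h0]
    · simp [hn, h7, NExp.eval, reg]
    · simp [hn, h5, NExp.eval, reg]
      ring
    · rw [← hD, ← hr 2 (by norm_num)]
      simp
    · rw [← hM, ← hr 3 (by norm_num)]
      simp
    · have hp : (reg 5).eval υ + 0 = υ.nat 5 0 := rfl
      rw [hp, hs, map_eval_wallExps hD hM h7] at hs'
      rw [List.range_succ, List.flatMap_append, ← List.append_assoc, List.flatMap_singleton, ← hs']
      have hlen : wallExps.length = 27 := rfl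
      simp [hn, NExp.eval, reg, hlen, Store.slice]
  · rintro υ ⟨h0, h7, -⟩
    simp [Test.holds, NExp.eval, reg, h0, h7]
  · refine ⟨?_, ?_, ?_, ?_, ?_, ?_⟩
    · simp [hn, h0]
    · simp [hn, h7]
    · simp [NExp.eval]
    · rw [hD, ← hr 2 (by norm_num)]
      simp
    · rw [hM, ← hr 3 (by norm_num)]
      simp
    · have hlen : headerExps.length = 49 := rfl
      rw [map_eval_headerExps hM.symm, hlen] at hs
      simpa [NExp.eval, Store.slice] using hs
  · rintro υ ⟨-, -, -, -, -, hs⟩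
    rw [hs, h.encode_linkInstance]

/-- Ask the oracle, and decide whether its answer lies between `1` and `4`. -/
def askOracle : Cmd :=
  .seq (.query 1 (reg 5) 9) <|
  .ite (.and (.natLt (.const 0) (reg 9)) (.natLt (reg 9) (.const 5)))
    (.putNat 0 (.const 0) (.const 1)) (.putNat 0 (.const 0) (.const 0))

open Classical in
theorem exec_askOracle {σ : Store} {q : List ℝ} (hq : σ.slice 1 (σ.nat 5 0) = q) :
    ∃ τ, Exec O askOracle σ τ 3 [q] ∧ τ.nat 0 0 = if 0 < O q ∧ O q < 5 then 1 else 0 := by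
  have hquery := Exec.query (O := O) 1 (reg 5) 9 σ
  rw [show σ.slice 1 ((reg 5).eval σ) = q from hq] at hquery
  set σ' := σ.setNat 9 0 (O q) with hσ'
  have e : (reg 9).eval σ' = O q := by simp [hσ', reg, NExp.eval]
  by_cases hb : 0 < O q ∧ O q < 5
  · refine ⟨_, .seq hquery (.ite_true ?_ (.putNat _ _ _ _)), ?_⟩
    · simpa [Test.holds, NExp.eval, e] using hb
    · simp [NExp.eval, hb]
  · refine ⟨_, .seq hquery (.ite_false ?_ (.putNat _ _ _ _)), ?_⟩
    · simpa [Test.holds, NExp.eval, e] using hb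
    · rw [if_neg hb]
      simp [NExp.eval]

/-- The program that solves 3SUM with one call to an oracle for link distances or for three-link
paths. -/
def reduction : Cmd := .seq (.seq (.seq (.seq initRuns sortRuns) collect) emit) askOracle

end RealRAM

/-! ### The running time -/

/-- Harmonic sums are bounded by square roots, as `1 / (m + 1) ≤ 2 (√(m + 1) - √m)`. -/
theorem sum_div_succ_le (K m : ℕ) :
    ∑ j ∈ Finset.range m, ((K / (j + 1) : ℕ) : ℝ) ≤ 2 * K * √m := by
  induction m with
  | zero => simp
  | succ m ih =>
    rw [Finset.sum_range_succ]
    have h1 : ((K / (m + 1) : ℕ) : ℝ) ≤ K / ((m + 1 : ℕ) : ℝ) := Nat.cast_div_le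
    have h2 : 1 / ((m + 1 : ℕ) : ℝ) ≤ 2 * (√((m + 1 : ℕ) : ℝ) - √m) := by
      push_cast
      have hm : (0 : ℝ) ≤ m := m.cast_nonneg
      have ha := Real.sq_sqrt hm
      have hb := Real.sq_sqrt (show (0 : ℝ) ≤ (m : ℝ) + 1 by positivity)
      have ha0 := Real.sqrt_nonneg (m : ℝ)
      have hab : √(m : ℝ) ≤ √((m : ℝ) + 1) := Real.sqrt_le_sqrt (by linarith)
      have hb1 : √((m : ℝ) + 1) ≤ m + 1 := Real.sqrt_le_iff.2 ⟨by linarith, by nlinarith⟩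
      rw [div_le_iff₀ (by linarith)]
      nlinarith
    have h3 : (K : ℝ) / ((m + 1 : ℕ) : ℝ) ≤ K * (2 * (√((m + 1 : ℕ) : ℝ) - √m)) := by
      rw [div_eq_mul_one_div]
      exact mul_le_mul_of_nonneg_left h2 K.cast_nonneg
    linarith

/-- The total cost of all merges is of order `n ^ (3 / 2)`. -/
theorem sum_merge_steps_le (n : ℕ) :
    ((∑ r ∈ Finset.range (n - 1), (5 * ((2 * n - 1) / (n - 1 - r)) + 6 + 1) : ℕ) : ℝ) ≤
      20 * ((n + 1) * √(n + 1)) + 7 * (n + 1) := by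
  have h1 : ∑ r ∈ Finset.range (n - 1), (2 * n - 1) / (n - 1 - r) =
      ∑ j ∈ Finset.range (n - 1), (2 * n - 1) / (j + 1) := by
    rw [← Finset.sum_range_reflect]
    refine Finset.sum_congr rfl fun r hr => ?_
    rw [Finset.mem_range] at hr
    congr 1
    omega
  have h2 := sum_div_succ_le (2 * n - 1) (n - 1)
  have h3 : ((2 * n - 1 : ℕ) : ℝ) ≤ 2 * (n + 1) := by
    exact_mod_cast (show 2 * n - 1 ≤ 2 * (n + 1) by omega)
  have h4 : √((n - 1 : ℕ) : ℝ) ≤ √((n : ℝ) + 1) :=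
    Real.sqrt_le_sqrt (by exact_mod_cast (show n - 1 ≤ n + 1 by omega))
  have h5 : ((n - 1 : ℕ) : ℝ) ≤ n + 1 := by exact_mod_cast (show n - 1 ≤ n + 1 by omega)
  have h6 : 2 * ((2 * n - 1 : ℕ) : ℝ) * √((n - 1 : ℕ) : ℝ) ≤
      2 * (2 * (n + 1)) * √((n : ℝ) + 1) := by
    gcongr
  simp only [add_assoc, Finset.sum_add_distrib, ← Finset.mul_sum, h1, Finset.sum_const,
    Finset.card_range, smul_eq_mul]
  push_cast
  linarith

/-! ### The reduction -/

open RealRAM in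
/-- A problem is 3SUM-hard if it contains the instances of framed sequences, and its answers, cut
to the range from `1` to `4`, tell whether these have a three-link path. -/
theorem threeSumHard_of_framed (B : Problem)
    (hB : ∀ (D : ℕ → ℝ) (n : ℕ) (M : ℝ) (h : Framed D n M), ∃ y : B.Inst,
      B.encode y = h.linkInstance.encode ∧ B.size y = h.linkInstance.domain.numVertices ∧
      (0 < B.answer y ∧ B.answer y < 5 ↔
        h.domain.HasLinkPath (Framed.source M) (Framed.target M) 3)) :
    ThreeSumHard B := by
  refine ⟨reduction, 1, 200, 1 / 2, by norm_num, fun O hO ⟨l, hl⟩ => ?_⟩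
  set L := l.map fun a : ℤ => (a : ℝ) with hL
  set n := l.length with hn
  have hruns : Runs O (.seq (.seq (.seq initRuns sortRuns) collect) emit) (initStore L)
      (3 * (n + 1) + 1 +
        (∑ r ∈ Finset.range (n - 1), (5 * ((2 * n - 1) / (n - 1 - r)) + 6 + 1) + 1) +
        (4 * n + 4) + (30 * n + 81)) fun τ =>
      ∃ (D : ℕ → ℝ) (M : ℝ) (h : Framed D n M),
        (∀ v, v ∈ L ↔ ∃ k, 1 ≤ k ∧ k ≤ n ∧ D k = v) ∧
        τ.slice 1 (τ.nat 5 0) = h.linkInstance.encode := by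
    refine ((runs_sort (by simp [hn])).seq fun τ hτ => runs_collect hl hn.symm hτ).seq ?_
    rintro τ ⟨h0, h7, hfr, hmem⟩
    exact (runs_emit h0 h7 hfr).mono le_rfl fun υ hυ => ⟨_, _, hfr, hmem, hυ⟩
  obtain ⟨σ, t, hexec, ht, D, M, h, hmem, hs⟩ := hruns
  obtain ⟨y, hy, hsize, hans⟩ := hB D n M h
  rw [← hy] at hs
  obtain ⟨τ, hdec, hτ⟩ := exec_askOracle (O := O) hs
  rw [hO y] at hτ
  refine ⟨τ, t + 3, [] ++ [B.encode y], .seq hexec hdec, ?_, by simp, ?_, ?_⟩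
  · have hmemD : ∀ k, 1 ≤ k → k ≤ n → ∃ z ∈ l, (z : ℝ) = D k := fun k h1 h2 =>
      List.mem_map.1 ((hmem _).2 ⟨k, h1, h2, rfl⟩)
    have hmeml : ∀ z ∈ l, ∃ k, (1 ≤ k ∧ k ≤ n) ∧ D k = z := fun z hz => by
      obtain ⟨k, h1, h2, e⟩ := (hmem z).1 (List.mem_map.2 ⟨z, hz, rfl⟩)
      exact ⟨k, ⟨h1, h2⟩, e⟩
    have hiff : (0 < B.answer y ∧ B.answer y < 5) ↔
        ∃ a ∈ l, ∃ b ∈ l, ∃ c ∈ l, a + b + c = 0 := by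
      rw [hans, h.hasLinkPath_iff fun k h1 h2 => (hmemD k h1 h2).imp fun _ hz => hz.2.symm]
      constructor
      · rintro ⟨i, j, k, hi, hj, hk, hsum⟩
        obtain ⟨a, ha, hai⟩ := hmemD i hi.1 hi.2
        obtain ⟨b, hb, hbj⟩ := hmemD j hj.1 hj.2
        obtain ⟨c, hc, hck⟩ := hmemD k hk.1 hk.2
        rw [← hai, ← hbj, ← hck] at hsum
        exact ⟨a, ha, b, hb, c, hc, by exact_mod_cast hsum⟩
      · rintro ⟨a, ha, b, hb, c, hc, hsum⟩
        obtain ⟨i, hi, hai⟩ := hmeml a ha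
        obtain ⟨j, hj, hbj⟩ := hmeml b hb
        obtain ⟨k, hk, hck⟩ := hmeml c hc
        exact ⟨i, j, k, hi, hj, hk, by rw [hai, hbj, hck]; exact_mod_cast hsum⟩
    rw [hτ]
    exact if_congr hiff rfl rfl
  · intro q hq
    obtain rfl : q = B.encode y := by simpa using hq
    refine ⟨y, rfl, ?_⟩
    rw [hsize, h.numVertices]
    change 12 * n + 32 ≤ 200 * (n + 1)
    omega
  · change ((t + 3 : ℕ) : ℝ) ≤ (200 : ℕ) * ((n : ℝ) + 1) ^ (2 - 1 / 2 : ℝ)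
    have hn0 : (0 : ℝ) < n + 1 := by positivity
    have hpow : ((n : ℝ) + 1) ^ (2 - 1 / 2 : ℝ) = (n + 1) * √(n + 1) := by
      rw [show (2 - 1 / 2 : ℝ) = 1 + 1 / 2 by norm_num, Real.rpow_add hn0, Real.rpow_one,
        Real.sqrt_eq_rpow]
    have hsqrt : (n : ℝ) + 1 ≤ (n + 1) * √(n + 1) :=
      le_mul_of_one_le_right hn0.le (Real.one_le_sqrt.2 (by simp))
    have ht' : ((t + 3 : ℕ) : ℝ) ≤ ((3 * (n + 1) + 1 +
        (∑ r ∈ Finset.range (n - 1), (5 * ((2 * n - 1) / (n - 1 - r)) + 6 + 1) + 1) +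
        (4 * n + 4) + (30 * n + 81) + 3 : ℕ) : ℝ) := Nat.cast_le.2 (by omega)
    have hsum := sum_merge_steps_le n
    generalize ∑ r ∈ Finset.range (n - 1), (5 * ((2 * n - 1) / (n - 1 - r)) + 6 + 1) = s
      at ht' hsum
    rw [hpow]
    push_cast at ht' ⊢
    have hn1 : (0 : ℝ) ≤ n := n.cast_nonneg
    linarith

theorem mainTheorem3 :
    ThreeSumHard linkDistanceProblem ∧ ThreeSumHard rectilinearThreeLinkProblem := by
  constructor
  -- The answer of the oracle is the link distance plus one, or zero, so the range from `1` to `4`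
  -- means link distance at most three.
  · refine threeSumHard_of_framed _ fun D n M h => ⟨⟨h.linkInstance, h.holes_ne_nil⟩, rfl, rfl, ?_⟩
    rw [← PolygonalDomain.linkDist_le_iff h.target_mem_carrier]
    simp only [linkDistanceProblem]
    change _ ↔ h.linkInstance.domain.linkDist h.linkInstance.s h.linkInstance.t ≤ _
    generalize h.linkInstance.domain.linkDist h.linkInstance.s h.linkInstance.t = d
    split_ifs with hd
    · simp [hd]
    · lift d to ℕ using hd
      simp only [ENat.toNat_natCast, Nat.cast_le]
      omega
  · refine threeSumHard_of_framed _ fun D n M h =>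
      ⟨⟨h.linkInstance, h.holes_ne_nil, h.isRectilinear⟩, rfl, rfl, ?_⟩
    simp only [rectilinearThreeLinkProblem]
    change _ ↔ h.linkInstance.domain.HasLinkPath h.linkInstance.s h.linkInstance.t 3
    split_ifs with hp <;> simp [hp]
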